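/- Let $M$ be a Hausdorff $C^\infty$ manifold of finite dimension $n$, and let $F:TM\to\mathbb R$ be a Finsler metric: $F$ is continuous, $C^\infty$ off the zero section, positive on nonzero vectors, positively homogeneous of degree one on each tangent space, and for every $x\in M$ and $p\in T_xM\setminus\{0_x\}$ the bilinear form $g_{(x,p)}=\tfrac12 D^2(F^2(x,\cdot))(p)$ on $T_xM$ is positive definite. Geodesics of $F$ are the $C^2$ curves that satisfy, in every chart, the Euler–Lagrange equations of $\tfrac12F^2$ (the constant curves included). For $x\in M$ let $\widetilde U_x\subseteq T_xM$ be the set of those $X$ for which the geodesic $c_X$ with $c_X(0)=x$, $\dot c_X(0)=X$ is defined on $[0,1]$, and for $X\in\widetilde U_x$ put $\mathrm{Exp}_x(X)=c_X(1)$. Let $L(\gamma)=\int_a^b F(\gamma(t),\dot\gamma(t))\,dt\in[0,\infty]$ denote the Finslerian length of a curve $\gamma:[a,b]\to M$. **Proposition 1.2.** Let $x\in M$ and $X\in\widetilde U_x$. Let $s_1>0$ and let $\widetilde b:[0,s_1]\to\widetilde U_x$ be a differentiable curve with $\widetilde b(0)=0_x$ and $\widetilde b(s_1)=X$. Put $b(s)=\mathrm{Exp}_x(\widetilde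 b(s))$ for $s\in[0,s_1]$ and $c(t)=\mathrm{Exp}_x(tX)$ for $t\in[0,1]$. Then: (i) $L(c)\le L(b)$. (ii) If $\widetilde b(s)=\tau(s)X$ for all $s\in[0,s_1]$, where $\tau:[0,s_1]\to[0,1]$ is a nondecreasing differentiable map, then $L(c)=L(b)$. (iii) If $L(c)=L(b)$ and the differential $(D\,\mathrm{Exp}_x)_{t\widetilde b(s)}$ has maximal rank $n$ for all $s\in[0,s_1]$ and $t\in[0,1]$, then there is a nondecreasing differentiable map $\tau:[0,s_1]\to[0,1]$ such that $\widetilde b(s)=\tau(s)X$ for all $s\in[0,s_1]$. Moreover $\tau$ is of class $C^k$ for every $k\in\{0,1,2,\dots,\infty\}$ for which $\widetilde b$ is of class $C^k$, and $\tau$ is strictly increasing if $\widetilde b$ is not constant on any subinterval $[u,v]\subseteq[0,s_1]$ with $u<v$. -/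

import Mathlib

open Set MeasureTheory
open scoped Manifold ContDiff Topology ENNReal

namespace Finsler

section Definitions

variable {E : Type*} [NormedAddCommGroup E] [NormedSpace ℝ E]
  {M : Type*} [TopologicalSpace M] [ChartedSpace E M] [IsManifold 𝓘(ℝ, E) ∞ M]

/-- The metric tensor `g_{(x,p)} = ½ D²(F²(x, ·))(p)` on `T_x M`, i.e. in linear coordinates
`g_{ij} = ½ ∂²F²/∂Xⁱ∂Xʲ`. In Mathlib the tangent space `T_x M` is the model space `E` (read
through the preferred chart at `x`); tangent vectors at a fixed point `x` are written as elements
of `E` here, which also gives the canonical identification `T_p(T_x M) = T_x M`. -/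
noncomputable def metricTensor (F : TangentBundle 𝓘(ℝ, E) M → ℝ) (x : M) (p : E) :
    E →L[ℝ] E →L[ℝ] ℝ :=
  (1 / 2 : ℝ) • fderiv ℝ (fderiv ℝ (fun v : E => F ⟨x, v⟩ ^ 2)) p

/-- `F : TM → ℝ` is a Finsler metric: it is continuous, smooth off the zero section,
positive on nonzero vectors, positively homogeneous of degree one on each tangent space, and its
metric tensor is positive definite at each nonzero vector. Reversibility, `F(-X) = F(X)`, is
not required. -/
structure IsFinslerMetric (F : TangentBundle 𝓘(ℝ, E) M → ℝ) : Prop where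
  continuous : Continuous F
  smooth : ContMDiffOn 𝓘(ℝ, E).tangent 𝓘(ℝ, ℝ) ∞ F {p | p.2 ≠ 0}
  pos : ∀ (x : M) (X : E), X ≠ 0 → 0 < F ⟨x, X⟩
  homogeneous : ∀ (x : M) (X : E) (a : ℝ), 0 ≤ a →
    F ⟨x, a • X⟩ = a * F ⟨x, X⟩
  posDef : ∀ (x : M) (p v : E), p ≠ 0 → v ≠ 0 → 0 < metricTensor F x p v v

/-- The complete lift `(c(t), ċ(t)) ∈ TM` of a curve `c` in `M`. -/
noncomputable def velocity (c : ℝ → M) (t : ℝ) : TangentBundle 𝓘(ℝ, E) M :=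
  ⟨c t, mfderiv 𝓘(ℝ, ℝ) 𝓘(ℝ, E) c t (1 : ℝ)⟩

/-- The Finslerian length `∫ₐᵇ F(c(t), ċ(t)) dt ∈ [0, ∞]` of the curve `c` restricted to
`[a, b]`. The end points, which have measure zero, are left out, so that only the values of
`c` on `[a, b]` matter. -/
noncomputable def length (F : TangentBundle 𝓘(ℝ, E) M → ℝ) (c : ℝ → M) (a b : ℝ) : ℝ≥0∞ :=
  ∫⁻ t in Ioo a b, ENNReal.ofReal (F (velocity c t))

/-- The energy Lagrangian `½ F²` in the coordinates given by the chart `e`; here `q` is the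
position and `v` the velocity in these coordinates. -/
noncomputable def chartLagrangian (F : TangentBundle 𝓘(ℝ, E) M → ℝ)
    (e : OpenPartialHomeomorph M E) (q v : E) : ℝ :=
  (1 / 2 : ℝ) * F ⟨e.symm q, mfderiv 𝓘(ℝ, E) 𝓘(ℝ, E) e.symm q v⟩ ^ 2

/-- `c` is a geodesic of `F` on the open set `J` of times: it is of class `C²` there and, in each
chart, it satisfies the Euler-Lagrange equations `d/dt (∂L/∂v (c, ċ)) = ∂L/∂q (c, ċ)` of the
energy Lagrangian `L = ½ F²`. Such curves have constant speed; the constant curves are the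
geodesics of speed zero. -/
def IsGeodesicOn (F : TangentBundle 𝓘(ℝ, E) M → ℝ) (c : ℝ → M) (J : Set ℝ) : Prop :=
  ContMDiffOn 𝓘(ℝ, ℝ) 𝓘(ℝ, E) 2 c J ∧
    ∀ e ∈ atlas E M, ∀ t ∈ J, c t ∈ e.source →
      HasDerivAt
        (fun s => fderiv ℝ (fun v => chartLagrangian F e (e (c s)) v) (deriv (e ∘ c) s))
        (fderiv ℝ (fun q => chartLagrangian F e q (deriv (e ∘ c) t)) (e (c t))) t

/-- `c` is a geodesic defined on an open interval containing `[0, 1]`, with `c(0) = x` and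
`ċ(0) = X`. -/
def IsGeodesicFrom (F : TangentBundle 𝓘(ℝ, E) M → ℝ) (x : M) (X : E) (c : ℝ → M) : Prop :=
  velocity c 0 = (⟨x, X⟩ : TangentBundle 𝓘(ℝ, E) M) ∧
    ∃ δ : ℝ, 0 < δ ∧ IsGeodesicOn F c (Ioo (-δ) (1 + δ))

/-- The domain of `Exp_x`: the tangent vectors `X` at `x` whose geodesic is defined
on `[0, 1]`. -/
def expDomain (F : TangentBundle 𝓘(ℝ, E) M → ℝ) (x : M) : Set E :=
  {X | ∃ c : ℝ → M, IsGeodesicFrom F x X c}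

open Classical in
/-- The exponential map `Exp_x(X) = c_X(1)`, where `c_X` is the geodesic with `c_X(0) = x` and
`ċ_X(0) = X`. Outside `expDomain F x` the value `x` is a placeholder. -/
noncomputable def expMap (F : TangentBundle 𝓘(ℝ, E) M → ℝ) (x : M) (X : E) : M :=
  if h : ∃ c : ℝ → M, IsGeodesicFrom F x X c then h.choose 1 else x

/-- The total differential of `Exp_x` at the tangent vector `p` has maximal rank, i.e. its rank is
the dimension of `M`. -/
def ExpHasMaximalRankAt (F : TangentBundle 𝓘(ℝ, E) M → ℝ) (x : M) (p : E) : Prop :=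
  Module.finrank ℝ
      (LinearMap.range (mfderiv 𝓘(ℝ, E) 𝓘(ℝ, E) (expMap F x) p).toLinearMap) =
    Module.finrank ℝ E

end Definitions

end Finsler

/-!
Everything rests on a comparison of two rates. Let `β` be a curve in the domain of `Exp_x`, put
`b s = Exp_x (β s)`, and write `r s = F (x, β s)`. Wherever `β ≠ 0`, the function `r` is
differentiable and `r' ≤ F (b, ḃ)`. For this let `γ s` be the geodesic with initial velocity `β s`
and `T` its velocity at time `1`. The Gauss lemma (`IsGeodesicVariation.gauss_lemma`) reads
`g_T(T, ḃ) = r r'`, and the fundamental inequality (`IsFinslerMetric.fundamental`) reads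
`g_T(T, ḃ) ≤ F(T) F(ḃ) = r F(ḃ)`, with equality only if `ḃ` is a nonnegative multiple of `T`;
together they are `IsGeodesicVariation.deriv_norm_le_speed`.

Integration of `r' ≤ F (b, ḃ)` from the last zero of `β` on bounds the length of `b` below by
`r(s₁) = F (x, X)`, which is the length of `c` since geodesics have constant speed. If the lengths
agree, then `r` is monotone, `r' = F (b, ḃ)` almost everywhere, and hence `ḃ = (r' / r) T`. Both
sides are images under the differential of `Exp_x` at `β`, of `β'` and of `(r' / r) β`. Where this
differential is injective, `β' = (r' / r) β`, so the direction `β / r` has derivative zero almost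
everywhere and is constant (`IsExpCurve.eq_smul`).

The Gauss lemma is the first variation formula. In a chart the momentum `∂L/∂v` of `L = ½ F²`,
paired with the variation of the position, changes at the rate of the variation of `L`
(`hasDerivAt_momentum_apply`), and along geodesics from `x` that variation is `½ (r²)'`, constant
in time. It needs the geodesics `γ s` to depend differentiably on `s`, which is shown without a
smooth exponential map. A geodesic of nonzero speed is, in a chart, an integral curve of the
smooth field `lagrangianField`, so a local flow of that field, differentiable in the initial value
(`exists_local_flow`), carries differentiability in `s` from one time to nearby times, and the
connectedness of `[0, 1]` from time `0` to all times
(`IsGeodesicVariation.liftDifferentiableAt`). No completeness of geodesics and no invariance of the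
Euler-Lagrange equations under change of charts enters, because the geodesics `γ s` are given on all
of `[0, 1]` and solve the equations in every chart.
-/


set_option linter.unusedSectionVars false

namespace Finsler

/-! ### Differentiable dependence of solutions of an ODE on the initial value -/

section ODE

variable {G : Type*} [NormedAddCommGroup G] [NormedSpace ℝ G]

/-- Forward in time, the derivative of a family of solutions with respect to its parameter is the
solution `W` of the linearised equation: `f s₀ + (s - s₀) • W` solves the equation up to an error
of order `(s - s₀)²`, so Grönwall's inequality compares it with `f s`. -/
theorem hasDerivAt_solution_of_nonneg {Z : G → G} {D : G → G →L[ℝ] G} {U : Set G} (hU : IsOpen U)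
    {K : NNReal} (hK : LipschitzOnWith K Z U) {C : ℝ} (hC : 0 ≤ C)
    (hquad : ∀ a ∈ U, ∀ b ∈ U, ‖Z b - Z a - D a (b - a)‖ ≤ C * ‖b - a‖ ^ 2)
    {T : ℝ} (hT : 0 ≤ T) {f : ℝ → ℝ → G} {W : ℝ → G} {s₀ : ℝ}
    (hf : ∀ᶠ s in 𝓝 s₀, ∀ t ∈ Icc 0 T, HasDerivAt (f s) (Z (f s t)) t ∧ f s t ∈ U)
    (hW : ∀ t ∈ Icc 0 T, HasDerivAt W (D (f s₀ t) (W t)) t)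
    (h0 : HasDerivAt (fun s => f s 0) (W 0) s₀) :
    HasDerivAt (fun s => f s T) (W T) s₀ := by
  have hf0 := hf.self_of_nhds
  have hWc : ContinuousOn W (Icc 0 T) := fun t ht => (hW t ht).continuousAt.continuousWithinAt
  have hfc : ContinuousOn (f s₀) (Icc 0 T) :=
    fun t ht => (hf0 t ht).1.continuousAt.continuousWithinAt
  obtain ⟨B, hB⟩ := isCompact_Icc.exists_bound_of_continuousOn hWc
  have hB0 : 0 ≤ B := (norm_nonneg _).trans (hB 0 ⟨le_rfl, hT⟩)
  obtain ⟨δ, hδ, hδU⟩ := (isCompact_Icc.image_of_continuousOn hfc).exists_thickening_subset_open hU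
    (by rintro _ ⟨t, ht, rfl⟩; exact (hf0 t ht).2)
  have hsmall : ∀ᶠ s in 𝓝 s₀, |s - s₀| * B < δ := by
    have : Filter.Tendsto (fun s => |s - s₀| * B) (𝓝 s₀) (𝓝 (|s₀ - s₀| * B)) := by
      apply Continuous.tendsto; fun_prop
    rw [sub_self, abs_zero, zero_mul] at this
    exact this.eventually (gt_mem_nhds hδ)
  -- a positive Lipschitz constant keeps the closed form of the Grönwall bound uniform
  have hK1 : LipschitzOnWith (K + 1) Z U := hK.weaken (by simp)
  set k : ℝ := ((K + 1 : NNReal) : ℝ) with hk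
  have hkpos : 0 < k := by rw [hk]; push_cast; positivity
  have key : ∀ᶠ s in 𝓝 s₀, ‖f s T - f s₀ T - (s - s₀) • W T‖ ≤
      ‖f s 0 - f s₀ 0 - (s - s₀) • W 0‖ * Real.exp (k * T) +
        C * (|s - s₀| * B) ^ 2 / k * (Real.exp (k * T) - 1) := by
    filter_upwards [hf, hsmall] with s hs hsm
    have hgU : ∀ t ∈ Icc 0 T, f s₀ t + (s - s₀) • W t ∈ U := by
      intro t ht
      apply hδU
      rw [Metric.mem_thickening_iff]
      refine ⟨f s₀ t, mem_image_of_mem _ ht, ?_⟩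
      rw [dist_eq_norm, add_sub_cancel_left, norm_smul, Real.norm_eq_abs]
      exact (mul_le_mul_of_nonneg_left (hB t ht) (abs_nonneg _)).trans_lt hsm
    have hgd : ∀ t ∈ Icc 0 T, HasDerivAt (fun t => f s₀ t + (s - s₀) • W t)
        (Z (f s₀ t) + (s - s₀) • D (f s₀ t) (W t)) t :=
      fun t ht => (hf0 t ht).1.add ((hW t ht).const_smul _)
    have := dist_le_of_approx_trajectories_ODE_of_mem (v := fun _ => Z) (s := fun _ => U)
      (K := K + 1) (f := f s) (g := fun t => f s₀ t + (s - s₀) • W t) (a := 0) (b := T)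
      (f' := fun t => Z (f s t)) (g' := fun t => Z (f s₀ t) + (s - s₀) • D (f s₀ t) (W t))
      (εf := 0) (εg := C * (|s - s₀| * B) ^ 2) (δ := ‖f s 0 - f s₀ 0 - (s - s₀) • W 0‖)
      (fun _ _ => hK1) (fun t ht => (hs t ht).1.continuousAt.continuousWithinAt)
      (fun t ht => (hs t (Ico_subset_Icc_self ht)).1.hasDerivWithinAt)
      (fun t _ => by simp)
      (fun t ht => (hs t (Ico_subset_Icc_self ht)).2)
      (fun t ht => (hgd t ht).continuousAt.continuousWithinAt)
      (fun t ht => (hgd t (Ico_subset_Icc_self ht)).hasDerivWithinAt)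
      (fun t ht => by
        have ht' := Ico_subset_Icc_self ht
        have h1 := hquad _ (hf0 t ht').2 _ (hgU t ht')
        rw [dist_comm, dist_eq_norm]
        have e1 : f s₀ t + (s - s₀) • W t - f s₀ t = (s - s₀) • W t := add_sub_cancel_left _ _
        rw [e1, map_smul] at h1
        rw [← sub_sub]
        refine h1.trans (mul_le_mul_of_nonneg_left ?_ hC)
        rw [norm_smul, Real.norm_eq_abs]
        have := hB t ht'
        gcongr)
      (fun t ht => hgU t (Ico_subset_Icc_self ht))
      (by rw [dist_eq_norm, sub_sub])
      T ⟨hT, le_rfl⟩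
    rw [dist_eq_norm, gronwallBound_of_K_ne_0 hkpos.ne', zero_add, sub_zero, ← sub_sub] at this
    exact this
  rw [hasDerivAt_iff_isLittleO]
  refine Asymptotics.IsBigO.trans_isLittleO (Asymptotics.IsBigO.of_bound' ?_) (g := fun s =>
    ‖f s 0 - f s₀ 0 - (s - s₀) • W 0‖ * Real.exp (k * T) +
        C * (|s - s₀| * B) ^ 2 / k * (Real.exp (k * T) - 1)) ?_
  · filter_upwards [key] with s hs
    exact hs.trans (le_abs_self _)
  · have h1 := (hasDerivAt_iff_isLittleO.1 h0).norm_left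
    refine Asymptotics.IsLittleO.add ?_ ?_
    · simpa only [mul_comm] using h1.const_mul_left (Real.exp (k * T))
    · have h2 : (fun s => (s - s₀) ^ 2) =o[𝓝 s₀] fun s => s - s₀ :=
        (Asymptotics.isLittleO_pow_sub_sub s₀ one_lt_two).congr_left fun s => by
          rw [Real.norm_eq_abs, sq_abs]
      refine (h2.const_mul_left (C * B ^ 2 / k * (Real.exp (k * T) - 1))).congr_left fun s => ?_
      rw [mul_pow, sq_abs]; ring

theorem hasDerivAt_solution {Z : G → G} {D : G → G →L[ℝ] G} {U : Set G} (hU : IsOpen U)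
    {K : NNReal} (hK : LipschitzOnWith K Z U) {C : ℝ} (hC : 0 ≤ C)
    (hquad : ∀ a ∈ U, ∀ b ∈ U, ‖Z b - Z a - D a (b - a)‖ ≤ C * ‖b - a‖ ^ 2)
    {ε : ℝ} {f : ℝ → ℝ → G} {W : ℝ → G} {s₀ : ℝ}
    (hf : ∀ᶠ s in 𝓝 s₀, ∀ t ∈ Ioo (-ε) ε, HasDerivAt (f s) (Z (f s t)) t ∧ f s t ∈ U)
    (hW : ∀ t ∈ Ioo (-ε) ε, HasDerivAt W (D (f s₀ t) (W t)) t)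
    (h0 : HasDerivAt (fun s => f s 0) (W 0) s₀) {t : ℝ} (ht : t ∈ Ioo (-ε) ε) :
    HasDerivAt (fun s => f s t) (W t) s₀ := by
  rcases le_total 0 t with h | h
  · have hsub : Icc 0 t ⊆ Ioo (-ε) ε := fun r hr =>
      ⟨by linarith [ht.2, hr.1], by linarith [ht.2, hr.2]⟩
    exact hasDerivAt_solution_of_nonneg hU hK hC hquad h
      (hf.mono fun s hs r hr => hs r (hsub hr)) (fun r hr => hW r (hsub hr)) h0
  · -- reversing time turns solutions for `Z` into solutions for `-Z`
    have hsub : ∀ r ∈ Icc 0 (-t), -r ∈ Ioo (-ε) ε := fun r hr =>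
      ⟨by linarith [ht.1, hr.2], by linarith [ht.1, hr.1]⟩
    have := hasDerivAt_solution_of_nonneg (Z := fun y => -Z y) (D := fun y => -D y) (T := -t)
      (f := fun s r => f s (-r)) (W := fun r => W (-r)) (s₀ := s₀) hU
      (K := K) (fun a ha b hb => by simpa only [edist_neg_neg] using hK ha hb) hC
      (fun a ha b hb => by
        have := hquad a ha b hb
        rw [← norm_neg] at this
        refine le_trans (le_of_eq ?_) this
        congr 1
        simp only [neg_apply]
        abel) (by linarith)
      (hf.mono fun s hs r hr => ⟨by
          have := (hs (-r) (hsub r hr)).1.scomp r (hasDerivAt_neg r)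
          simpa [Function.comp_def] using this, (hs (-r) (hsub r hr)).2⟩)
      (fun r hr => by
          have := (hW (-r) (hsub r hr)).scomp r (hasDerivAt_neg r)
          simpa [Function.comp_def] using this)
      (by simpa using h0)
    simpa using this

/-- A `C²` map is locally Lipschitz, with a quadratic remainder in its first order expansion. -/
theorem exists_lipschitzOnWith_quadratic_remainder {Z : G → G} {z₀ : G}
    (hZ : ContDiffAt ℝ 2 Z z₀) {N : Set G} (hN : N ∈ 𝓝 z₀) :
    ∃ R > 0, Metric.ball z₀ R ⊆ N ∧ ∃ K : NNReal, LipschitzOnWith K Z (Metric.ball z₀ R) ∧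
      ∃ C : ℝ, 0 ≤ C ∧ ∀ a ∈ Metric.ball z₀ R, ∀ b ∈ Metric.ball z₀ R,
        ‖Z b - Z a - fderiv ℝ Z a (b - a)‖ ≤ C * ‖b - a‖ ^ 2 := by
  obtain ⟨K, s, hs, hK⟩ := (hZ.of_le (by norm_num : (1 : WithTop ℕ∞) ≤ 2)).exists_lipschitzOnWith
  have hD : ContDiffAt ℝ 1 (fderiv ℝ Z) z₀ := hZ.fderiv_right (by norm_num)
  obtain ⟨C, s', hs', hC⟩ := hD.exists_lipschitzOnWith
  have hev : ∀ᶠ z in 𝓝 z₀, DifferentiableAt ℝ Z z := by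
    filter_upwards [hZ.eventually (by simp)] with z hz
    exact hz.differentiableAt (by norm_num)
  obtain ⟨R, hR, hRs⟩ := Metric.mem_nhds_iff.1
    (Filter.inter_mem (Filter.inter_mem hN hev) (Filter.inter_mem hs hs'))
  refine ⟨R, hR, fun z hz => (hRs hz).1.1, K, hK.mono fun z hz => (hRs hz).2.1, C, C.2, ?_⟩
  intro a ha b hb
  have hseg : segment ℝ a b ⊆ Metric.ball z₀ R := (convex_ball z₀ R).segment_subset ha hb
  have := (convex_segment a b).norm_image_sub_le_of_norm_hasFDerivWithin_le'
    (f := Z) (f' := fderiv ℝ Z) (φ := fderiv ℝ Z a) (C := C * ‖b - a‖) (x := a) (y := b)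
    (fun z hz => (hRs (hseg hz)).1.2.hasFDerivAt.hasFDerivWithinAt)
    (fun z hz => by
      have h1 := hC.dist_le_mul z (hRs (hseg hz)).2.2 a (hRs ha).2.2
      rw [dist_eq_norm] at h1
      refine h1.trans (mul_le_mul_of_nonneg_left ?_ C.2)
      have := norm_sub_le_of_mem_segment hz
      rwa [dist_eq_norm])
    (left_mem_segment ℝ a b) (right_mem_segment ℝ a b)
  rw [sq, ← mul_assoc]
  exact this

/-- Local flow of a `C²` vector field, with its derivative in the initial value. The flow comes
from the Picard-Lindelöf theorem for the field `(Z y, DZ(y) w)`, whose second component supplies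
the solutions of the linearised equation. -/
theorem exists_local_flow [CompleteSpace G] {Z : G → G} {z₀ : G} (hZ : ContDiffAt ℝ 2 Z z₀)
    {N : Set G} (hN : N ∈ 𝓝 z₀) :
    ∃ ε > 0, ∃ V ∈ 𝓝 z₀, ∃ Φ : G → ℝ → G,
      (∀ z ∈ V, Φ z 0 = z ∧ ∀ t ∈ Ioo (-ε) ε, Φ z t ∈ N ∧ HasDerivAt (Φ z) (Z (Φ z t)) t) ∧
      ∀ z ∈ V, ∀ w, ∃ W : ℝ → G, W 0 = w ∧
        (∀ t ∈ Ioo (-ε) ε, HasDerivAt W (fderiv ℝ Z (Φ z t) (W t)) t) ∧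
        ∀ (y : ℝ → G) (s₀ : ℝ), y s₀ = z → HasDerivAt y w s₀ → ∀ t ∈ Ioo (-ε) ε,
          HasDerivAt (fun s => Φ (y s) t) (W t) s₀ := by
  obtain ⟨R, hR, hRN, K, hK, C, hC, hquad⟩ := exists_lipschitzOnWith_quadratic_remainder hZ hN
  have hD : ContDiffAt ℝ 1 (fderiv ℝ Z) z₀ := hZ.fderiv_right (by norm_num)
  let Zh : G × G → G × G := fun p => (Z p.1, fderiv ℝ Z p.1 p.2)
  have hZh : ContDiffAt ℝ 1 Zh (z₀, 0) := by
    have h1 : ContDiffAt ℝ 1 (fun p : G × G => Z p.1) (z₀, 0) :=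
      ContDiffAt.comp (z₀, (0 : G)) (hZ.of_le (by norm_num)) contDiffAt_fst
    have h2 : ContDiffAt ℝ 1 (fun p : G × G => fderiv ℝ Z p.1) (z₀, 0) :=
      ContDiffAt.comp (z₀, (0 : G)) hD contDiffAt_fst
    exact h1.prodMk (h2.clm_apply contDiffAt_snd)
  obtain ⟨ε₀, hε₀, a, r, L, K', hr, hPL⟩ := IsPicardLindelof.of_contDiffAt_one hZh
  obtain ⟨α, hα, hαc⟩ := (hPL 0).exists_forall_mem_closedBall_eq_hasDerivWithinAt_continuousOn
  simp only [zero_sub, zero_add] at hα hαc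
  have hr' : (0 : ℝ) < r := hr
  have hc0 : ContinuousAt α ((z₀, 0), 0) := by
    apply hαc.continuousAt
    rw [nhds_prod_eq]
    exact Filter.prod_mem_prod (Metric.closedBall_mem_nhds _ hr')
      (Icc_mem_nhds (by linarith) (by linarith))
  have hα0 : α ((z₀, 0), 0) = (z₀, 0) := (hα _ (Metric.mem_closedBall_self hr'.le)).1
  have hball : ∀ᶠ p in 𝓝 (((z₀, 0), 0) : (G × G) × ℝ), (α p).1 ∈ Metric.ball z₀ R := by
    apply (continuous_fst.continuousAt.comp hc0).eventually_mem
    simp only [Function.comp, hα0]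
    exact Metric.ball_mem_nhds _ hR
  rw [nhds_prod_eq, nhds_prod_eq, Filter.eventually_prod_iff] at hball
  obtain ⟨p1, hp1, p2, hp2, hpp⟩ := hball
  rw [Filter.eventually_prod_iff] at hp1
  obtain ⟨q1, hq1, q2, hq2, hqq⟩ := hp1
  obtain ⟨ε₁, hε₁, hε₁'⟩ := Metric.eventually_nhds_iff.1 hp2
  let ε := min ε₀ ε₁
  have hε : 0 < ε := lt_min hε₀ hε₁
  have hT : ∀ t ∈ Ioo (-ε) ε, p2 t ∧ Icc (-ε₀) ε₀ ∈ 𝓝 t := by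
    intro t ht
    have h1 : ε ≤ ε₀ := min_le_left _ _
    have h2 : ε ≤ ε₁ := min_le_right _ _
    refine ⟨hε₁' ?_, Icc_mem_nhds (by linarith [ht.1]) (by linarith [ht.2])⟩
    rw [Real.dist_eq, sub_zero, abs_lt]
    exact ⟨by linarith [ht.1], by linarith [ht.2]⟩
  have hV : {z | q1 z} ∩ Metric.closedBall z₀ r ∈ 𝓝 z₀ :=
    Filter.inter_mem hq1 (Metric.closedBall_mem_nhds _ hr')
  -- the solutions of the enlarged system that start near `(z₀, 0)`
  have hsol : ∀ z w, q1 z → z ∈ Metric.closedBall z₀ r → q2 w → w ∈ Metric.closedBall (0 : G) r →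
      α ((z, w), 0) = (z, w) ∧ ∀ t ∈ Ioo (-ε) ε, (α ((z, w), t)).1 ∈ Metric.ball z₀ R ∧
        HasDerivAt (fun t => α ((z, w), t)) (Zh (α ((z, w), t))) t := by
    intro z w hz hz' hw hw'
    have hmem : (z, w) ∈ Metric.closedBall ((z₀, 0) : G × G) r := by
      rw [← closedBall_prod_same]; exact ⟨hz', hw'⟩
    refine ⟨(hα _ hmem).1, fun t ht => ⟨hpp (hqq hz hw) (hT t ht).1, ?_⟩⟩
    exact ((hα _ hmem).2 t (mem_of_mem_nhds (hT t ht).2)).hasDerivAt (hT t ht).2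
  have hq20 : q2 0 := hq2.self_of_nhds
  have hr0 : (0 : G) ∈ Metric.closedBall (0 : G) r := Metric.mem_closedBall_self hr'.le
  have hΦ : ∀ z ∈ {z | q1 z} ∩ Metric.closedBall z₀ r, ∀ t ∈ Ioo (-ε) ε,
      HasDerivAt (fun t => (α ((z, 0), t)).1) (Z (α ((z, 0), t)).1) t ∧
        (α ((z, 0), t)).1 ∈ Metric.ball z₀ R := by
    intro z hz t ht
    have := (hsol z 0 hz.1 hz.2 hq20 hr0).2 t ht
    exact ⟨this.2.fst, this.1⟩
  refine ⟨ε, hε, interior ({z | q1 z} ∩ Metric.closedBall z₀ r), interior_mem_nhds.2 hV,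
    fun z t => (α ((z, 0), t)).1, ?_, ?_⟩
  · intro z hz
    replace hz := interior_subset hz
    refine ⟨congrArg Prod.fst (hsol z 0 hz.1 hz.2 hq20 hr0).1, fun t ht => ?_⟩
    exact ⟨hRN (hΦ z hz t ht).2, (hΦ z hz t ht).1⟩
  · intro z hzV w
    have hz := interior_subset hzV
    -- scale `w` into the domain of the enlarged flow; the linearised equation scales back
    obtain ⟨κ, hκ, hκw⟩ : ∃ κ : ℝ, 0 < κ ∧ q2 (κ • w) ∧ κ • w ∈ Metric.closedBall (0 : G) r := by
      have h1 : Filter.Tendsto (fun κ : ℝ => κ • w) (𝓝[>] 0) (𝓝 0) := by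
        have : Filter.Tendsto (fun κ : ℝ => κ • w) (𝓝 0) (𝓝 ((0 : ℝ) • w)) :=
          (continuous_id.smul continuous_const).tendsto 0
        rw [zero_smul] at this
        exact this.mono_left nhdsWithin_le_nhds
      obtain ⟨κ, h2, h3⟩ := ((h1.eventually (hq2.and (Metric.closedBall_mem_nhds _ hr'))).and
        self_mem_nhdsWithin).exists
      exact ⟨κ, h3, h2⟩
    have hs := hsol z (κ • w) hz.1 hz.2 hκw.1 hκw.2
    have heq : EqOn (fun t => (α ((z, κ • w), t)).1) (fun t => (α ((z, 0), t)).1) (Ioo (-ε) ε) := by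
      refine ODE_solution_unique_of_mem_Ioo (v := fun _ => Z) (s := fun _ => Metric.ball z₀ R)
        (K := K) (fun _ _ => hK) (t₀ := 0) ⟨by linarith, hε⟩
        (fun t ht => ⟨(hs.2 t ht).2.fst, (hs.2 t ht).1⟩) (hΦ z hz) ?_
      rw [hs.1, (hsol z 0 hz.1 hz.2 hq20 hr0).1]
    have hW : ∀ t ∈ Ioo (-ε) ε, HasDerivAt (fun t => κ⁻¹ • (α ((z, κ • w), t)).2)
        (fderiv ℝ Z (α ((z, 0), t)).1 (κ⁻¹ • (α ((z, κ • w), t)).2)) t := by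
      intro t ht
      have h1 := (hasFDerivAt_snd.comp_hasDerivAt t (hs.2 t ht).2).const_smul κ⁻¹
      have h2 : (α ((z, κ • w), t)).1 = (α ((z, 0), t)).1 := heq ht
      rw [← h2, map_smul]
      exact h1
    have hW0 : κ⁻¹ • (α ((z, κ • w), 0)).2 = w := by rw [hs.1]; simp [smul_smul, hκ.ne']
    refine ⟨fun t => κ⁻¹ • (α ((z, κ • w), t)).2, hW0, hW, ?_⟩
    intro y s₀ hy hyd t ht
    have hev : ∀ᶠ s in 𝓝 s₀, y s ∈ interior ({z | q1 z} ∩ Metric.closedBall z₀ r) :=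
      hyd.continuousAt.eventually_mem (isOpen_interior.mem_nhds (hy ▸ hzV))
    refine hasDerivAt_solution (Z := Z) (D := fderiv ℝ Z) (ε := ε)
      (f := fun s t => (α ((y s, 0), t)).1) (s₀ := s₀)
      (W := fun t => κ⁻¹ • (α ((z, κ • w), t)).2)
      Metric.isOpen_ball hK hC hquad ?_ ?_ ?_ ht
    · filter_upwards [hev] with s hs t ht using hΦ _ (interior_subset hs) t ht
    · simpa only [hy] using hW
    · rw [hW0]
      refine hyd.congr_of_eventuallyEq ?_
      filter_upwards [hev] with s hs
      exact congrArg Prod.fst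
        (hsol _ 0 (interior_subset hs).1 (interior_subset hs).2 hq20 hr0).1

end ODE

/-! ### The fundamental inequality of a Minkowski norm -/

section Minkowski

variable {E : Type*} [NormedAddCommGroup E] [NormedSpace ℝ E] {N : E → ℝ}

/-- Euler's relation for `N²`, which is homogeneous of degree two. -/
theorem fderiv_sq_apply_self (hom : ∀ (v : E) (a : ℝ), 0 ≤ a → N (a • v) = a * N v) {T : E}
    (hd : DifferentiableAt ℝ (fun v => N v ^ 2) T) :
    fderiv ℝ (fun v => N v ^ 2) T T = 2 * N T ^ 2 := by
  have h1 : HasDerivAt (fun t : ℝ => t • T) T 1 := by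
    simpa using (hasDerivAt_id (1 : ℝ)).smul_const T
  have h2 : HasDerivAt (fun t : ℝ => N (t • T) ^ 2) (fderiv ℝ (fun v => N v ^ 2) T T) 1 := by
    have h3 : HasFDerivAt (fun v => N v ^ 2) (fderiv ℝ (fun v => N v ^ 2) T) ((1 : ℝ) • T) := by
      rw [one_smul]; exact hd.hasFDerivAt
    exact h3.comp_hasDerivAt 1 h1
  have h4 : HasDerivAt (fun t : ℝ => t ^ 2 * N T ^ 2) (2 * N T ^ 2) 1 := by
    simpa using (hasDerivAt_pow 2 (1 : ℝ)).mul_const (N T ^ 2)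
  refine h2.unique (h4.congr_of_eventuallyEq ?_)
  filter_upwards [lt_mem_nhds (zero_lt_one (α := ℝ))] with t ht
  rw [hom T t ht.le, mul_pow]

/-- A function whose second derivative is positive definite along a segment lies strictly above
its tangent plane at one end of the segment. -/
theorem apply_sub_lt_of_second_deriv_pos {g : E → ℝ} {g' : E → E →L[ℝ] ℝ}
    {g'' : E → E →L[ℝ] E →L[ℝ] ℝ} {T w : E} (hne : w ≠ T)
    (hg : ∀ p ∈ segment ℝ T w, HasFDerivAt g (g' p) p)
    (hg' : ∀ p ∈ segment ℝ T w, HasFDerivAt g' (g'' p) p)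
    (hpos : ∀ p ∈ segment ℝ T w, ∀ v, v ≠ 0 → 0 < g'' p v v) :
    g' T (w - T) < g w - g T := by
  have hseg : ∀ t ∈ Icc (0 : ℝ) 1, T + t • (w - T) ∈ segment ℝ T w := by
    intro t ht
    rw [segment_eq_image']
    exact ⟨t, ht, rfl⟩
  have hl : ∀ t : ℝ, HasDerivAt (fun t : ℝ => T + t • (w - T)) (w - T) t := by
    intro t
    simpa using ((hasDerivAt_id t).smul_const (w - T)).const_add T
  have h1 : ∀ t ∈ Icc (0 : ℝ) 1, HasDerivAt (fun t : ℝ => g (T + t • (w - T)))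
      (g' (T + t • (w - T)) (w - T)) t := fun t ht =>
    (hg _ (hseg t ht)).comp_hasDerivAt t (hl t)
  have h2 : ∀ t ∈ Icc (0 : ℝ) 1, HasDerivAt (fun t : ℝ => g' (T + t • (w - T)) (w - T))
      (g'' (T + t • (w - T)) (w - T) (w - T)) t := fun t ht => by
    have h3 : HasDerivAt (fun t : ℝ => g' (T + t • (w - T)))
      (g'' (T + t • (w - T)) (w - T)) t := (hg' _ (hseg t ht)).comp_hasDerivAt t (hl t)
    exact (ContinuousLinearMap.apply ℝ ℝ (w - T)).hasFDerivAt.comp_hasDerivAt t h3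
  obtain ⟨ξ, hξ, hξe⟩ := exists_hasDerivAt_eq_slope (fun t : ℝ => g (T + t • (w - T)))
    (fun t => g' (T + t • (w - T)) (w - T)) zero_lt_one
    (fun t ht => (h1 t ht).continuousAt.continuousWithinAt)
    (fun t ht => h1 t (Ioo_subset_Icc_self ht))
  have hξ1 : Icc 0 ξ ⊆ Icc (0 : ℝ) 1 := Icc_subset_Icc_right hξ.2.le
  obtain ⟨η, hη, hηe⟩ := exists_hasDerivAt_eq_slope
    (fun t => g' (T + t • (w - T)) (w - T))
    (fun t => g'' (T + t • (w - T)) (w - T) (w - T)) hξ.1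
    (fun t ht => (h2 t (hξ1 ht)).continuousAt.continuousWithinAt)
    (fun t ht => h2 t (hξ1 (Ioo_subset_Icc_self ht)))
  have hpos' := hpos _ (hseg η (hξ1 (Ioo_subset_Icc_self hη))) (w - T) (sub_ne_zero.2 hne)
  rw [hηe, div_pos_iff_of_pos_right (by linarith [hξ.1]), zero_smul, add_zero] at hpos'
  rw [zero_smul, add_zero, one_smul, add_sub_cancel, sub_zero, div_one] at hξe
  linarith

/-- The fundamental inequality `g_T(T, w) ≤ N T * N w` of a positively homogeneous function with
positive definite metric tensor, with its equality case. When `w` is rescaled to the level of `T`,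
it compares `N²` with its tangent plane at `T`; the negative multiples of `T`, for which the segment
from `T` meets the origin, are treated directly. -/
theorem fundamental_inequality (pos : ∀ v, v ≠ 0 → 0 < N v)
    (hom : ∀ (v : E) (a : ℝ), 0 ≤ a → N (a • v) = a * N v)
    (hsm : ∀ v, v ≠ 0 → ContDiffAt ℝ 2 N v)
    (hpd : ∀ p, p ≠ 0 → ∀ v, v ≠ 0 → 0 < fderiv ℝ (fderiv ℝ (fun v => N v ^ 2)) p v v)
    {T : E} (hT : T ≠ 0) (w : E) :
    fderiv ℝ (fun v => N v ^ 2) T w ≤ 2 * (N T * N w) ∧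
      (fderiv ℝ (fun v => N v ^ 2) T w = 2 * (N T * N w) → w = (N w / N T) • T) := by
  have hsq : ∀ v, v ≠ 0 → ContDiffAt ℝ 2 (fun v => N v ^ 2) v := fun v hv => (hsm v hv).pow 2
  have hNT := pos T hT
  have hTT := fderiv_sq_apply_self hom ((hsq T hT).differentiableAt (by norm_num))
  rcases eq_or_ne w 0 with rfl | hw
  · have h0 : N 0 = 0 := by simpa using hom 0 0 le_rfl
    simp [h0]
  have hNw := pos w hw
  by_cases hseg : ∃ a : ℝ, 0 < a ∧ w = -(a • T)
  · obtain ⟨a, ha, hwa⟩ := hseg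
    have h1 : fderiv ℝ (fun v => N v ^ 2) T w < 2 * (N T * N w) := by
      have : 0 < a * (2 * N T ^ 2) := by positivity
      have : 0 < N T * N w := by positivity
      rw [hwa] at *
      rw [map_neg, map_smul, hTT, smul_eq_mul]
      linarith
    exact ⟨h1.le, fun h => absurd h h1.ne⟩
  · -- rescale `w` to the level set of `T`
    set μ : ℝ := N T / N w with hμ
    have hμp : 0 < μ := by positivity
    have hNμ : N (μ • w) = N T := by rw [hom w μ hμp.le, hμ]; field_simp
    have h0 : ∀ p ∈ segment ℝ T (μ • w), p ≠ 0 := by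
      rintro p ⟨a, b, ha, hb, hab, rfl⟩ hp
      rcases hb.eq_or_lt with rfl | hb
      · rw [zero_smul, add_zero] at hp
        obtain rfl : a = 1 := by linarith
        exact hT (by simpa using hp)
      rcases ha.eq_or_lt with rfl | ha
      · rw [zero_smul, zero_add] at hp
        simp [hb.ne', hμp.ne', hw] at hp
      · refine hseg ⟨(b * μ)⁻¹ * a, by positivity, ?_⟩
        have h3 : (b * μ) • w = -(a • T) := by
          rw [mul_smul]; exact eq_neg_of_add_eq_zero_right hp
        rw [mul_smul, ← smul_neg, ← h3, smul_smul, inv_mul_cancel₀ (by positivity), one_smul]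
    have hwμ : w = (N w / N T) • (μ • w) := by
      rw [smul_smul, hμ, div_mul_div_cancel₀' hNw.ne', div_self hNT.ne', one_smul]
    by_cases hne : μ • w = T
    · have h4 : fderiv ℝ (fun v => N v ^ 2) T w = 2 * (N T * N w) := by
        conv_lhs => rw [hwμ, hne]
        rw [map_smul, hTT, smul_eq_mul]; field_simp
      exact ⟨h4.le, fun _ => by conv_lhs => rw [hwμ, hne]⟩
    · have h5 := apply_sub_lt_of_second_deriv_pos hne
        (fun p hp => ((hsq p (h0 p hp)).differentiableAt (by norm_num)).hasFDerivAt)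
        (fun p hp => (((hsq p (h0 p hp)).fderiv_right (m := 1) (by norm_num)).differentiableAt
          (by norm_num)).hasFDerivAt) (fun p hp => hpd p (h0 p hp))
      rw [map_sub, map_smul, hTT, hNμ, sub_self, smul_eq_mul, hμ] at h5
      have h6 : fderiv ℝ (fun v => N v ^ 2) T w < 2 * (N T * N w) := by
        have : N T / N w * fderiv ℝ (fun v => N v ^ 2) T w < N T / N w * (2 * (N T * N w)) := by
          have : N T / N w * (2 * (N T * N w)) = 2 * N T ^ 2 := by field_simp
          linarith
        exact lt_of_mul_lt_mul_left this hμp.le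
      exact ⟨h6.le, fun h => absurd h h6.ne⟩

end Minkowski

/-! ### Tangent vectors and curves in a chart -/

section Charts

variable {E : Type*} [NormedAddCommGroup E] [NormedSpace ℝ E]
  {M : Type*} [TopologicalSpace M] [ChartedSpace E M] [IsManifold 𝓘(ℝ, E) ∞ M]

/-- The inverse of the chart of `TM` induced by the chart `e` of `M`: it sends the coordinates
`(q, v)` of a position and a velocity to the tangent vector that they represent. -/
noncomputable def chartTangent (e : OpenPartialHomeomorph M E) (z : E × E) :
    TangentBundle 𝓘(ℝ, E) M :=
  ⟨e.symm z.1, mfderiv 𝓘(ℝ, E) 𝓘(ℝ, E) e.symm z.1 z.2⟩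

theorem contMDiffOn_chartTangent {e : OpenPartialHomeomorph M E} (he : e ∈ atlas E M) :
    ContMDiffOn 𝓘(ℝ, E × E) 𝓘(ℝ, E).tangent ∞ (chartTangent e) (e.target ×ˢ univ) := by
  have h1 : ContMDiffOn 𝓘(ℝ, E) 𝓘(ℝ, E) ∞ e.symm e.target :=
    contMDiffOn_symm_of_mem_maximalAtlas (IsManifold.subset_maximalAtlas he)
  have h2 := h1.contMDiffOn_tangentMapWithin (m := ∞) (by simp) e.open_target.uniqueMDiffOn
  have h3 : ContMDiff 𝓘(ℝ, E × E) 𝓘(ℝ, E).tangent ∞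
      (fun z : E × E => (⟨z.1, z.2⟩ : TangentBundle 𝓘(ℝ, E) E)) := by
    have := contMDiff_tangentBundleModelSpaceHomeomorph_symm (I := 𝓘(ℝ, E)) (n := ∞)
    rw [modelWithCornersSelf_prod]
    exact this
  refine (h2.comp h3.contMDiffOn (s := e.target ×ˢ univ) ?_).congr ?_
  · rintro ⟨q, v⟩ hz
    exact hz.1
  · rintro ⟨q, v⟩ hz
    simp only [Function.comp, tangentMapWithin, chartTangent]
    rw [← mfderivWithin_of_isOpen e.open_target hz.1]

variable {F : TangentBundle 𝓘(ℝ, E) M → ℝ}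

theorem chartTangent_snd_ne_zero {e : OpenPartialHomeomorph M E} (he : e ∈ atlas E M) {z : E × E}
    (hz : z.1 ∈ e.target) (hv : z.2 ≠ 0) : (chartTangent e z : TangentBundle 𝓘(ℝ, E) M).2 ≠ 0 := by
  intro h
  apply hv
  exact (mdifferentiable_of_mem_atlas (I := 𝓘(ℝ, E)) he).symm.mfderiv_injective hz
    (h.trans (map_zero _).symm)

theorem IsFinslerMetric.contDiffOn_chart (hF : IsFinslerMetric F)
    {e : OpenPartialHomeomorph M E} (he : e ∈ atlas E M) :
    ContDiffOn ℝ ∞ (fun z => F (chartTangent e z)) (e.target ×ˢ {0}ᶜ) := by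
  rw [← contMDiffOn_iff_contDiffOn]
  refine hF.smooth.comp
    ((contMDiffOn_chartTangent he).mono (prod_mono subset_rfl (subset_univ _))) ?_
  rintro ⟨q, v⟩ hz
  exact chartTangent_snd_ne_zero he hz.1 hz.2

theorem IsFinslerMetric.continuousOn_chart (hF : IsFinslerMetric F)
    {e : OpenPartialHomeomorph M E} (he : e ∈ atlas E M) :
    ContinuousOn (fun z => F (chartTangent e z)) (e.target ×ˢ univ) :=
  hF.continuous.comp_continuousOn (contMDiffOn_chartTangent he).continuousOn

/-- A curve in the coordinates of `e`, together with its velocity. -/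
noncomputable def chartLift (e : OpenPartialHomeomorph M E) (c : ℝ → M) (t : ℝ) : E × E :=
  (e (c t), deriv (e ∘ c) t)

theorem deriv_chart_comp {e : OpenPartialHomeomorph M E} (he : e ∈ atlas E M) {c : ℝ → M} {t : ℝ}
    (hc : MDifferentiableAt 𝓘(ℝ, ℝ) 𝓘(ℝ, E) c t) (ht : c t ∈ e.source) :
    HasDerivAt (e ∘ c)
      (mfderiv 𝓘(ℝ, E) 𝓘(ℝ, E) e (c t) (mfderiv 𝓘(ℝ, ℝ) 𝓘(ℝ, E) c t (1 : ℝ))) t := by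
  have h1 := (mdifferentiable_of_mem_atlas (I := 𝓘(ℝ, E)) he).mdifferentiableAt ht
  have key : ∀ (A : E →L[ℝ] E) (B : ℝ →L[ℝ] E), HasFDerivAt (e ∘ c) (A.comp B) t →
      HasDerivAt (e ∘ c) (A (B 1)) t := fun A B h => h.hasDerivAt
  exact key _ _ (h1.hasMFDerivAt.comp t hc.hasMFDerivAt).hasFDerivAt

theorem chartTangent_chartLift {e : OpenPartialHomeomorph M E} (he : e ∈ atlas E M) {c : ℝ → M}
    {t : ℝ} (hc : MDifferentiableAt 𝓘(ℝ, ℝ) 𝓘(ℝ, E) c t) (ht : c t ∈ e.source) :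
    chartTangent e (chartLift e c t) = velocity c t := by
  have h1 : deriv (e ∘ c) t = _ := (deriv_chart_comp he hc ht).deriv
  have h2 := (mdifferentiable_of_mem_atlas (I := 𝓘(ℝ, E)) he).symm_comp_deriv ht
  have h3 := DFunLike.congr_fun h2 (mfderiv 𝓘(ℝ, ℝ) 𝓘(ℝ, E) c t (1 : ℝ))
  unfold chartTangent chartLift velocity
  rw [h1]
  exact congrArg₂ (fun (p : M) (w : E) => (⟨p, w⟩ : TangentBundle 𝓘(ℝ, E) M)) (e.left_inv ht) h3

end Charts

/-! ### The Euler-Lagrange equations as a first order equation -/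

section EulerLagrange

variable {E : Type*} [NormedAddCommGroup E] [NormedSpace ℝ E]

/-- The momentum `∂L/∂v` of a Lagrangian `L (q, v)`. -/
noncomputable def momentum (L : E × E → ℝ) (z : E × E) : E →L[ℝ] ℝ :=
  (fderiv ℝ L z).comp (ContinuousLinearMap.inr ℝ E E)

/-- The second derivative `∂²L/∂v²` of a Lagrangian `L (q, v)` in the velocity. -/
noncomputable def fibreHessian (L : E × E → ℝ) (z : E × E) : E →L[ℝ] E →L[ℝ] ℝ :=
  (fderiv ℝ (momentum L) z).comp (ContinuousLinearMap.inr ℝ E E)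

/-- The vector field on the phase space of pairs `(q, v)` whose integral curves are the solutions
of the Euler-Lagrange equations of `L`, provided that `∂²L/∂v²` is invertible. -/
noncomputable def lagrangianField (L : E × E → ℝ) (z : E × E) : E × E :=
  (z.2, (fibreHessian L z).inverse ((fderiv ℝ L z).comp (ContinuousLinearMap.inl ℝ E E) -
    fderiv ℝ (momentum L) z (z.2, 0)))

variable {L : E × E → ℝ}

theorem contDiffAt_momentum {z : E × E} (hL : ContDiffAt ℝ ∞ L z) :
    ContDiffAt ℝ ∞ (momentum L) z :=
  (hL.fderiv_right (m := ∞) (by simp)).clm_comp contDiffAt_const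

theorem fderiv_velocity_eq {q v : E} (hL : DifferentiableAt ℝ L (q, v)) :
    fderiv ℝ (fun v => L (q, v)) v = momentum L (q, v) :=
  (hL.hasFDerivAt.comp v (hasFDerivAt_prodMk_right q v)).fderiv

theorem fderiv_position_eq {q v : E} (hL : DifferentiableAt ℝ L (q, v)) :
    fderiv ℝ (fun q => L (q, v)) q =
      (fderiv ℝ L (q, v)).comp (ContinuousLinearMap.inl ℝ E E) :=
  (hL.hasFDerivAt.comp q (hasFDerivAt_prodMk_left q v)).fderiv

theorem eventually_differentiableAt {z : E × E} (hL : ContDiffAt ℝ ∞ L z) :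
    ∀ᶠ y in 𝓝 z, DifferentiableAt ℝ L y := by
  filter_upwards [(hL.of_le (m := 1) (by simp)).eventually (by simp)] with y hy
  exact hy.differentiableAt (by simp)

theorem fderiv_fderiv_velocity_eq {q v : E} (hL : ContDiffAt ℝ ∞ L (q, v)) :
    fderiv ℝ (fderiv ℝ (fun v => L (q, v))) v = fibreHessian L (q, v) := by
  have h1 : HasFDerivAt (fun v => momentum L (q, v)) (fibreHessian L (q, v)) v :=
    ((contDiffAt_momentum hL).differentiableAt (by simp)).hasFDerivAt.comp v
      (hasFDerivAt_prodMk_right q v)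
  refine (h1.congr_of_eventuallyEq ?_).fderiv
  have hc : ContinuousAt (fun v : E => (q, v)) v := by fun_prop
  filter_upwards [hc.eventually (eventually_differentiableAt hL)] with w hw
  exact fderiv_velocity_eq hw

theorem isInvertible_fibreHessian [FiniteDimensional ℝ E] {z : E × E}
    (hpos : ∀ w, w ≠ 0 → 0 < fibreHessian L z w w) : (fibreHessian L z).IsInvertible := by
  have hinj : Function.Injective (fibreHessian L z).toLinearMap := by
    rw [← LinearMap.ker_eq_bot, LinearMap.ker_eq_bot']
    intro w hw
    by_contra hne
    have h1 := hpos w hne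
    have h2 : fibreHessian L z w = 0 := hw
    rw [h2] at h1
    simp at h1
  have hdim : Module.finrank ℝ E = Module.finrank ℝ (E →L[ℝ] ℝ) := by
    rw [← (LinearMap.toContinuousLinearMap (𝕜 := ℝ) (E := E) (F' := ℝ)).finrank_eq]
    exact Subspace.dual_finrank_eq.symm
  refine ⟨(LinearEquiv.ofInjectiveOfFinrankEq _ hinj hdim).toContinuousLinearEquiv, ?_⟩
  ext1 w
  rfl

theorem contDiffAt_lagrangianField [FiniteDimensional ℝ E] {z : E × E} (hL : ContDiffAt ℝ ∞ L z)
    (hpos : ∀ w, w ≠ 0 → 0 < fibreHessian L z w w) : ContDiffAt ℝ ∞ (lagrangianField L) z := by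
  have := FiniteDimensional.complete ℝ E
  have h1 := (contDiffAt_momentum hL).fderiv_right (m := ∞) (by simp)
  have h2 : ContDiffAt ℝ ∞ (fibreHessian L) z := h1.clm_comp contDiffAt_const
  have h3 : ContDiffAt ℝ ∞ (fun z => (fibreHessian L z).inverse) z :=
    (isInvertible_fibreHessian hpos).contDiffAt_map_inverse.comp z h2
  have h4 : ContDiffAt ℝ ∞ (fun z => (fderiv ℝ L z).comp (ContinuousLinearMap.inl ℝ E E)) z :=
    (hL.fderiv_right (m := ∞) (by simp)).clm_comp contDiffAt_const
  have h5 : ContDiffAt ℝ ∞ (fun z : E × E => fderiv ℝ (momentum L) z (z.2, 0)) z :=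
    h1.clm_apply (contDiffAt_snd.prodMk contDiffAt_const)
  exact contDiffAt_snd.prodMk (h3.clm_apply (h4.sub h5))

/-- A curve in phase space that satisfies the Euler-Lagrange equations is an integral curve of
`lagrangianField L`. -/
theorem hasDerivAt_lagrangianField [FiniteDimensional ℝ E] {z : ℝ → E × E} {t : ℝ} {a : E}
    (hL : ContDiffAt ℝ ∞ L (z t)) (hpos : ∀ w, w ≠ 0 → 0 < fibreHessian L (z t) w w)
    (hz : HasDerivAt z ((z t).2, a) t)
    (hEL : HasDerivAt (fun s => momentum L (z s))
      ((fderiv ℝ L (z t)).comp (ContinuousLinearMap.inl ℝ E E)) t) :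
    HasDerivAt z (lagrangianField L (z t)) t := by
  convert hz using 1
  unfold lagrangianField
  congr 1
  have h1 : HasDerivAt (fun s => momentum L (z s)) (fderiv ℝ (momentum L) (z t) ((z t).2, a)) t :=
    ((contDiffAt_momentum hL).differentiableAt (by simp)).hasFDerivAt.comp_hasDerivAt t hz
  have h2 : ((z t).2, a) = ((z t).2, (0 : E)) + (0, a) := by simp
  rw [hEL.unique h1, h2, map_add, add_sub_cancel_left]
  obtain ⟨A, hA⟩ := isInvertible_fibreHessian hpos
  have h3 : fderiv ℝ (momentum L) (z t) (0, a) = A a := by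
    change _ = (A : E →L[ℝ] E →L[ℝ] ℝ) a
    rw [hA]; rfl
  rw [h3, ← hA]
  simp

/-- Along a solution `z` of the Euler-Lagrange equations, with a variation field `w`, the pairing of
the momentum with the variation of the position changes at the rate of the variation of `L`. -/
theorem hasDerivAt_momentum_apply {z w : ℝ → E × E} {t : ℝ}
    (hEL : HasDerivAt (fun s => momentum L (z s))
      ((fderiv ℝ L (z t)).comp (ContinuousLinearMap.inl ℝ E E)) t)
    (hw : HasDerivAt (fun s => (w s).1) (w t).2 t) :
    HasDerivAt (fun s => momentum L (z s) (w s).1) (fderiv ℝ L (z t) (w t)) t := by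
  have h2 : fderiv ℝ L (z t) (w t) =
      fderiv ℝ L (z t) ((w t).1, (0 : E)) + fderiv ℝ L (z t) (0, (w t).2) := by
    rw [← map_add]; simp
  rw [h2]
  exact hEL.clm_apply hw

/-- Conservation of energy for a Lagrangian that is homogeneous of degree two in the velocity. -/
theorem hasDerivAt_lagrangian_eq_zero {z : ℝ → E × E} {t : ℝ} {a : E}
    (hL : DifferentiableAt ℝ L (z t)) (hz : HasDerivAt z ((z t).2, a) t)
    (heuler : ∀ᶠ s in 𝓝 t, momentum L (z s) (z s).2 = 2 * L (z s))
    (hEL : HasDerivAt (fun s => momentum L (z s))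
      ((fderiv ℝ L (z t)).comp (ContinuousLinearMap.inl ℝ E E)) t) :
    HasDerivAt (fun s => L (z s)) 0 t := by
  have h1 : HasDerivAt (fun s => L (z s)) (fderiv ℝ L (z t) ((z t).2, a)) t :=
    hL.hasFDerivAt.comp_hasDerivAt t hz
  have hv : HasDerivAt (fun s => (z s).2) a t :=
    (hasFDerivAt_snd (p := z t)).comp_hasDerivAt t hz
  have h2 := hasDerivAt_momentum_apply (w := fun s => ((z s).2, a)) hEL hv
  have h3 := (h2.congr_of_eventuallyEq (heuler.mono fun s hs => hs.symm)).unique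
    (h1.const_mul 2)
  have h4 : fderiv ℝ L (z t) ((z t).2, a) = 0 := by linarith
  rwa [h4] at h1

end EulerLagrange

/-! ### The energy of a Finsler metric in a chart -/

section ChartEnergy

variable {E : Type*} [NormedAddCommGroup E] [NormedSpace ℝ E]
  {M : Type*} [TopologicalSpace M] [ChartedSpace E M] [IsManifold 𝓘(ℝ, E) ∞ M]

/-- The energy Lagrangian `½ F²` in the chart `e`, as a function on phase space. -/
noncomputable def chartEnergy (F : TangentBundle 𝓘(ℝ, E) M → ℝ) (e : OpenPartialHomeomorph M E)
    (z : E × E) : ℝ :=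
  chartLagrangian F e z.1 z.2

variable {F : TangentBundle 𝓘(ℝ, E) M → ℝ} {e : OpenPartialHomeomorph M E}

theorem chartEnergy_eq (z : E × E) : chartEnergy F e z = 1 / 2 * F (chartTangent e z) ^ 2 := rfl

theorem IsFinslerMetric.contDiffAt_chartEnergy (hF : IsFinslerMetric F) (he : e ∈ atlas E M)
    {z : E × E} (hz : z.1 ∈ e.target) (hv : z.2 ≠ 0) : ContDiffAt ℝ ∞ (chartEnergy F e) z := by
  have hopen : IsOpen (e.target ×ˢ ({0}ᶜ : Set E)) := e.open_target.prod isOpen_compl_singleton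
  have h := (hF.contDiffOn_chart he).contDiffAt (hopen.mem_nhds ⟨hz, hv⟩)
  exact contDiffAt_const.mul (h.pow 2)

theorem IsFinslerMetric.contDiffAt_fibre (hF : IsFinslerMetric F) (x : M) {v : E} (hv : v ≠ 0) :
    ContDiffAt ℝ ∞ (fun v : E => F ⟨x, v⟩) v := by
  have he := chart_mem_atlas E x
  have hx := mem_chart_source E x
  have hmd := mdifferentiable_of_mem_atlas (I := 𝓘(ℝ, E)) he
  let A : E →L[ℝ] E := mfderiv 𝓘(ℝ, E) 𝓘(ℝ, E) (chartAt E x) x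
  have hA : ∀ w : E, F (chartTangent (chartAt E x) (chartAt E x x, A w)) = F ⟨x, w⟩ := by
    intro w
    have h3 := DFunLike.congr_fun (hmd.symm_comp_deriv hx) w
    exact congrArg F (congrArg₂ (fun (p : M) (w : E) => (⟨p, w⟩ : TangentBundle 𝓘(ℝ, E) M))
      ((chartAt E x).left_inv hx) h3)
  have hAv : A v ≠ 0 := fun h => hv (hmd.mfderiv_injective hx (h.trans (map_zero A).symm))
  have hopen : IsOpen ((chartAt E x).target ×ˢ ({0}ᶜ : Set E)) :=
    (chartAt E x).open_target.prod isOpen_compl_singleton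
  have h := (hF.contDiffOn_chart he).contDiffAt (x := (chartAt E x x, A v))
    (hopen.mem_nhds ⟨(chartAt E x).map_source hx, hAv⟩)
  have h2 : ContDiffAt ℝ ∞ (fun w : E => (chartAt E x x, A w)) v :=
    contDiffAt_const.prodMk A.contDiff.contDiffAt
  have h4 : ContDiffAt ℝ ∞ (fun w : E => F (chartTangent (chartAt E x) (chartAt E x x, A w))) v :=
    ContDiffAt.comp (g := fun z => F (chartTangent (chartAt E x) z)) v h h2
  exact h4.congr_of_eventuallyEq (.of_forall fun w => (hA w).symm)

theorem IsFinslerMetric.apply_zero (hF : IsFinslerMetric F) (x : M) :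
    F ⟨x, (0 : E)⟩ = 0 := by
  simpa using hF.homogeneous x (0 : E) 0 le_rfl

theorem IsFinslerMetric.nonneg (hF : IsFinslerMetric F) (p : TangentBundle 𝓘(ℝ, E) M) :
    0 ≤ F p := by
  obtain ⟨x, v⟩ := p
  rcases eq_or_ne v 0 with rfl | hv
  · exact (hF.apply_zero x).ge
  · exact (hF.pos x v hv).le

theorem IsFinslerMetric.fundamental (hF : IsFinslerMetric F) (x : M) {T : E} (hT : T ≠ 0) (w : E) :
    fderiv ℝ (fun v : E => F ⟨x, v⟩ ^ 2) T w ≤ 2 * (F ⟨x, T⟩ * F ⟨x, w⟩) ∧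
      (fderiv ℝ (fun v : E => F ⟨x, v⟩ ^ 2) T w = 2 * (F ⟨x, T⟩ * F ⟨x, w⟩) →
        w = (F ⟨x, w⟩ / F ⟨x, T⟩) • T) := by
  refine fundamental_inequality (N := fun v : E => F ⟨x, v⟩) (hF.pos x) (hF.homogeneous x)
    (fun v hv => (hF.contDiffAt_fibre x hv).of_le (by norm_cast)) ?_ hT w
  intro p hp v hv
  have := hF.posDef x p v hp hv
  unfold metricTensor at this
  rw [FunLike.coe_smul, Pi.smul_apply, FunLike.coe_smul, Pi.smul_apply, smul_eq_mul] at this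
  linarith

theorem fderiv_fderiv_comp_clm {g : E → ℝ} {A : E →L[ℝ] E} {v : E} (hg : ContDiffAt ℝ 2 g (A v))
    (a : ℝ) (w : E) : fderiv ℝ (fderiv ℝ (fun v => a * g (A v))) v w w =
      a * fderiv ℝ (fderiv ℝ g) (A v) (A w) (A w) := by
  have h1 : fderiv ℝ (fun v => a * g (A v)) =ᶠ[𝓝 v]
      fun v => a • (ContinuousLinearMap.compL ℝ E E ℝ).flip A (fderiv ℝ g (A v)) := by
    have hev : ∀ᶠ y in 𝓝 (A v), DifferentiableAt ℝ g y := by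
      filter_upwards [hg.eventually (by simp)] with y hy using hy.differentiableAt (by simp)
    filter_upwards [A.continuous.continuousAt.eventually hev] with y hy
    exact ((hy.hasFDerivAt.comp y A.hasFDerivAt).const_mul a).fderiv
  have h2 : DifferentiableAt ℝ (fderiv ℝ g) (A v) :=
    (hg.fderiv_right (m := 1) (by norm_num)).differentiableAt (by norm_num)
  have h3 := (((ContinuousLinearMap.compL ℝ E E ℝ).flip A).hasFDerivAt.comp v
    (h2.hasFDerivAt.comp v A.hasFDerivAt)).const_smul a
  have h4 := (h3.congr_of_eventuallyEq h1).fderiv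
  rw [h4]
  simp

theorem IsFinslerMetric.fibreHessian_pos (hF : IsFinslerMetric F) (he : e ∈ atlas E M)
    {z : E × E} (hz : z.1 ∈ e.target) (hv : z.2 ≠ 0) (w : E) (hw : w ≠ 0) :
    0 < fibreHessian (chartEnergy F e) z w w := by
  obtain ⟨q, v⟩ := z
  simp only at hz hv
  rw [← fderiv_fderiv_velocity_eq (hF.contDiffAt_chartEnergy he hz hv)]
  let A : E →L[ℝ] E := mfderiv 𝓘(ℝ, E) 𝓘(ℝ, E) e.symm q
  have hA : ∀ u : E, u ≠ 0 → A u ≠ 0 := fun u hu => chartTangent_snd_ne_zero he (z := (q, u)) hz hu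
  have hg : ContDiffAt ℝ 2 (fun v : E => F ⟨e.symm q, v⟩ ^ 2) (A v) :=
    ((hF.contDiffAt_fibre (e.symm q) (hA v hv)).of_le (by norm_cast)).pow 2
  have h1 := fderiv_fderiv_comp_clm hg (1 / 2) w
  have h2 := hF.posDef (e.symm q) (A v) (A w) (hA v hv) (hA w hw)
  unfold metricTensor at h2
  rw [FunLike.coe_smul, Pi.smul_apply, FunLike.coe_smul, Pi.smul_apply, smul_eq_mul, ← h1] at h2
  exact h2

theorem IsFinslerMetric.chartTangent_smul (hF : IsFinslerMetric F) (q v : E) {a : ℝ} (ha : 0 ≤ a) :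
    F (chartTangent e (q, a • v)) = a * F (chartTangent e (q, v)) := by
  refine Eq.trans ?_ (hF.homogeneous (e.symm q)
    (mfderiv 𝓘(ℝ, E) 𝓘(ℝ, E) e.symm q v) a ha)
  exact congrArg (fun w : E => F ⟨e.symm q, w⟩)
    (map_smul (mfderiv 𝓘(ℝ, E) 𝓘(ℝ, E) e.symm q) a v)

/-- Euler's relation for the energy, which is homogeneous of degree two in the velocity. -/
theorem IsFinslerMetric.momentum_self (hF : IsFinslerMetric F) (he : e ∈ atlas E M)
    {z : E × E} (hz : z.1 ∈ e.target) (hv : z.2 ≠ 0) :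
    momentum (chartEnergy F e) z z.2 = 2 * chartEnergy F e z := by
  obtain ⟨q, v⟩ := z
  simp only at hz hv
  have hL := hF.contDiffAt_chartEnergy he (z := (q, v)) hz hv
  rw [← fderiv_velocity_eq (hL.differentiableAt (by simp))]
  have hd : DifferentiableAt ℝ (fun v => chartEnergy F e (q, v)) v :=
    (hL.differentiableAt (by simp)).comp v (hasFDerivAt_prodMk_right q v).differentiableAt
  have hN : (fun v => F (chartTangent e (q, v)) ^ 2) = fun v => 2 * chartEnergy F e (q, v) := by
    funext v; rw [chartEnergy_eq]; ring
  have h1 := fderiv_sq_apply_self (N := fun v => F (chartTangent e (q, v))) (T := v)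
    (fun v a ha => hF.chartTangent_smul q v ha) (by rw [hN]; exact hd.const_mul 2)
  rw [hN, fderiv_const_mul hd] at h1
  rw [FunLike.coe_smul, Pi.smul_apply, smul_eq_mul] at h1
  have h2 : F (chartTangent e (q, v)) ^ 2 = 2 * chartEnergy F e (q, v) := congrFun hN v
  linarith

end ChartEnergy

/-! ### Geodesics in a chart -/

section Geodesics

variable {E : Type*} [NormedAddCommGroup E] [NormedSpace ℝ E]
  {M : Type*} [TopologicalSpace M] [ChartedSpace E M] [IsManifold 𝓘(ℝ, E) ∞ M]
  {F : TangentBundle 𝓘(ℝ, E) M → ℝ} {e : OpenPartialHomeomorph M E} {c : ℝ → M} {J : Set ℝ}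

theorem IsGeodesicOn.contMDiffAt (hc : IsGeodesicOn F c J) (hJ : IsOpen J) {t : ℝ} (ht : t ∈ J) :
    ContMDiffAt 𝓘(ℝ, ℝ) 𝓘(ℝ, E) 2 c t :=
  (hc.1 t ht).contMDiffAt (hJ.mem_nhds ht)

theorem IsGeodesicOn.mdifferentiableAt (hc : IsGeodesicOn F c J) (hJ : IsOpen J) {t : ℝ}
    (ht : t ∈ J) : MDifferentiableAt 𝓘(ℝ, ℝ) 𝓘(ℝ, E) c t :=
  (hc.contMDiffAt hJ ht).mdifferentiableAt (by norm_num)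

theorem IsGeodesicOn.continuousAt (hc : IsGeodesicOn F c J) (hJ : IsOpen J) {t : ℝ}
    (ht : t ∈ J) : ContinuousAt c t :=
  (hc.contMDiffAt hJ ht).continuousAt

theorem IsGeodesicOn.contDiffAt_chart (hc : IsGeodesicOn F c J) (hJ : IsOpen J)
    (he : e ∈ atlas E M) {t : ℝ} (ht : t ∈ J) (hte : c t ∈ e.source) :
    ContDiffAt ℝ 2 (e ∘ c) t := by
  rw [← contMDiffAt_iff_contDiffAt]
  have h1 : ContMDiffAt 𝓘(ℝ, E) 𝓘(ℝ, E) 2 e (c t) :=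
    (contMDiffAt_of_mem_maximalAtlas (n := ∞) (IsManifold.subset_maximalAtlas he) hte).of_le
      (by norm_cast)
  exact h1.comp t (hc.contMDiffAt hJ ht)

theorem IsGeodesicOn.hasDerivAt_chartLift (hc : IsGeodesicOn F c J) (hJ : IsOpen J)
    (he : e ∈ atlas E M) {t : ℝ} (ht : t ∈ J) (hte : c t ∈ e.source) :
    HasDerivAt (chartLift e c) ((chartLift e c t).2, deriv (deriv (e ∘ c)) t) t := by
  have h1 := hc.contDiffAt_chart hJ he ht hte
  have h2 : DifferentiableAt ℝ (deriv (e ∘ c)) t := by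
    have h3 := (h1.fderiv_right (m := 1) (by norm_num)).differentiableAt (by norm_num)
    exact h3.clm_apply (differentiableAt_const (1 : ℝ))
  exact (h1.differentiableAt (by norm_num)).hasDerivAt.prodMk h2.hasDerivAt

theorem IsGeodesicOn.continuousAt_chartLift (hc : IsGeodesicOn F c J) (hJ : IsOpen J)
    (he : e ∈ atlas E M) {t : ℝ} (ht : t ∈ J) (hte : c t ∈ e.source) :
    ContinuousAt (chartLift e c) t :=
  (hc.hasDerivAt_chartLift hJ he ht hte).continuousAt

theorem IsGeodesicOn.eventually_regular (hc : IsGeodesicOn F c J) (hJ : IsOpen J)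
    (he : e ∈ atlas E M) {t : ℝ} (ht : t ∈ J) (hte : c t ∈ e.source)
    (hv : (chartLift e c t).2 ≠ 0) :
    ∀ᶠ s in 𝓝 t, s ∈ J ∧ c s ∈ e.source ∧ (chartLift e c s).2 ≠ 0 := by
  filter_upwards [hJ.mem_nhds ht,
    (hc.continuousAt hJ ht).eventually_mem (e.open_source.mem_nhds hte),
    (continuous_snd.continuousAt.comp (hc.continuousAt_chartLift hJ he ht hte)).eventually_ne hv]
    with s h1 h2 h3 using ⟨h1, h2, h3⟩

theorem IsGeodesicOn.hasDerivAt_momentum (hF : IsFinslerMetric F) (hc : IsGeodesicOn F c J)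
    (hJ : IsOpen J) (he : e ∈ atlas E M) {t : ℝ} (ht : t ∈ J) (hte : c t ∈ e.source)
    (hv : (chartLift e c t).2 ≠ 0) :
    HasDerivAt (fun s => momentum (chartEnergy F e) (chartLift e c s))
      ((fderiv ℝ (chartEnergy F e) (chartLift e c t)).comp (ContinuousLinearMap.inl ℝ E E)) t := by
  have hdiff : ∀ s, c s ∈ e.source → (chartLift e c s).2 ≠ 0 →
      DifferentiableAt ℝ (chartEnergy F e) (chartLift e c s) := fun s hs hvs =>
    (hF.contDiffAt_chartEnergy he (e.map_source hs) hvs).differentiableAt (by simp)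
  have h1 := hc.2 e he t ht hte
  have h2 : fderiv ℝ (fun q => chartLagrangian F e q (deriv (e ∘ c) t)) (e (c t)) = _ :=
    fderiv_position_eq (L := chartEnergy F e) (hdiff t hte hv)
  rw [h2] at h1
  refine h1.congr_of_eventuallyEq ?_
  filter_upwards [hc.eventually_regular hJ he ht hte hv] with s hs
  exact (fderiv_velocity_eq (L := chartEnergy F e) (hdiff s hs.2.1 hs.2.2)).symm

theorem IsGeodesicOn.hasDerivAt_field [FiniteDimensional ℝ E] (hF : IsFinslerMetric F)
    (hc : IsGeodesicOn F c J) (hJ : IsOpen J) (he : e ∈ atlas E M) {t : ℝ} (ht : t ∈ J)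
    (hte : c t ∈ e.source) (hv : (chartLift e c t).2 ≠ 0) :
    HasDerivAt (chartLift e c) (lagrangianField (chartEnergy F e) (chartLift e c t)) t :=
  hasDerivAt_lagrangianField (hF.contDiffAt_chartEnergy he (e.map_source hte) hv)
    (hF.fibreHessian_pos he (e.map_source hte) hv) (hc.hasDerivAt_chartLift hJ he ht hte)
    (hc.hasDerivAt_momentum hF hJ he ht hte hv)

theorem velocity_snd_ne_zero_iff (he : e ∈ atlas E M) {t : ℝ}
    (hc : MDifferentiableAt 𝓘(ℝ, ℝ) 𝓘(ℝ, E) c t) (hte : c t ∈ e.source) :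
    (chartLift e c t).2 ≠ 0 ↔ (velocity c t : TangentBundle 𝓘(ℝ, E) M).2 ≠ 0 := by
  constructor
  · intro h
    rw [← chartTangent_chartLift he hc hte]
    exact chartTangent_snd_ne_zero he (e.map_source hte) h
  · intro h h0
    apply h
    rw [← chartTangent_chartLift he hc hte]
    change mfderiv 𝓘(ℝ, E) 𝓘(ℝ, E) e.symm (chartLift e c t).1 (chartLift e c t).2 = 0
    rw [h0]
    exact map_zero (mfderiv 𝓘(ℝ, E) 𝓘(ℝ, E) e.symm (chartLift e c t).1)

theorem IsFinslerMetric.apply_ne_zero_iff (hF : IsFinslerMetric F)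
    (p : TangentBundle 𝓘(ℝ, E) M) : F p ≠ 0 ↔ p.2 ≠ 0 := by
  obtain ⟨x, v⟩ := p
  constructor
  · intro h h0
    exact h ((congrArg (fun w : E => F ⟨x, w⟩) h0).trans (hF.apply_zero x))
  · intro h
    exact (hF.pos x v h).ne'

theorem IsGeodesicOn.hasDerivAt_speed (hF : IsFinslerMetric F) (hc : IsGeodesicOn F c J)
    (hJ : IsOpen J) {t : ℝ} (ht : t ∈ J) (hv : F (velocity c t) ≠ 0) :
    HasDerivAt (fun s => 1 / 2 * F (velocity c s) ^ 2) 0 t := by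
  obtain ⟨e, he, hte⟩ : ∃ e ∈ atlas E M, c t ∈ e.source :=
    ⟨chartAt E (c t), chart_mem_atlas E (c t), mem_chart_source E (c t)⟩
  have hv' := (velocity_snd_ne_zero_iff he (hc.mdifferentiableAt hJ ht) hte).2
    ((hF.apply_ne_zero_iff _).1 hv)
  have hreg := hc.eventually_regular hJ he ht hte hv'
  have h1 := hasDerivAt_lagrangian_eq_zero
    ((hF.contDiffAt_chartEnergy he (e.map_source hte) hv').differentiableAt (by simp))
    (hc.hasDerivAt_chartLift hJ he ht hte)
    (hreg.mono fun s hs => hF.momentum_self he (e.map_source hs.2.1) hs.2.2)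
    (hc.hasDerivAt_momentum hF hJ he ht hte hv')
  refine h1.congr_of_eventuallyEq ?_
  filter_upwards [hreg] with s hs
  rw [chartEnergy_eq, chartTangent_chartLift he (hc.mdifferentiableAt hJ hs.1) hs.2.1]

end Geodesics

/-! ### Constant speed, uniqueness and rescaling of geodesics -/

theorem IsPreconnected.iff_of_locally_iff {α : Type*} [TopologicalSpace α] {J : Set α}
    (hJ : IsPreconnected J) {P : α → Prop} (h : ∀ t ∈ J, ∀ᶠ s in 𝓝[J] t, (P s ↔ P t)) {t₁ t₂ : α}
    (h₁ : t₁ ∈ J) (h₂ : t₂ ∈ J) : P t₁ ↔ P t₂ := by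
  have : PreconnectedSpace J := isPreconnected_iff_preconnectedSpace.1 hJ
  have hl : IsLocallyConstant (fun t : J => P t) := by
    rw [IsLocallyConstant.iff_eventually_eq]
    intro t
    rw [nhds_subtype_eq_comap_nhdsWithin, Filter.eventually_comap]
    filter_upwards [h t t.2] with s hs a ha
    subst ha
    exact propext hs
  exact iff_of_eq (hl.apply_eq_of_preconnectedSpace ⟨t₁, h₁⟩ ⟨t₂, h₂⟩)

theorem eventually_ne_of_continuousAt {α β : Type*} [TopologicalSpace α] [TopologicalSpace β]
    [T2Space β] {f g : α → β} {t : α} (hf : ContinuousAt f t) (hg : ContinuousAt g t)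
    (h : f t ≠ g t) : ∀ᶠ s in 𝓝 t, f s ≠ g s :=
  (hf.prodMk hg).eventually_mem (isClosed_diagonal.isOpen_compl.mem_nhds h)

theorem eventually_eq_of_hasDerivAt_zero {G : Type*} [NormedAddCommGroup G] [NormedSpace ℝ G]
    {g : ℝ → G} {t : ℝ} (h : ∀ᶠ s in 𝓝 t, HasDerivAt g 0 s) : ∀ᶠ s in 𝓝 t, g s = g t := by
  obtain ⟨ε, hε, hball⟩ := Metric.eventually_nhds_iff_ball.1 h
  filter_upwards [Metric.ball_mem_nhds t hε] with s hs
  exact Metric.isOpen_ball.is_const_of_deriv_eq_zero (convex_ball t ε).isPreconnected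
    (fun r hr => (hball r hr).differentiableAt.differentiableWithinAt)
    (fun r hr => (hball r hr).deriv) hs (Metric.mem_ball_self hε)

section Geodesics

variable {E : Type*} [NormedAddCommGroup E] [NormedSpace ℝ E]
  {M : Type*} [TopologicalSpace M] [ChartedSpace E M] [IsManifold 𝓘(ℝ, E) ∞ M]
  {F : TangentBundle 𝓘(ℝ, E) M → ℝ} {e : OpenPartialHomeomorph M E} {c : ℝ → M} {J : Set ℝ}

theorem IsGeodesicOn.continuousAt_speed (hF : IsFinslerMetric F) (hc : IsGeodesicOn F c J)
    (hJ : IsOpen J) {t : ℝ} (ht : t ∈ J) : ContinuousAt (fun s => F (velocity c s)) t := by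
  obtain ⟨e, he, hte⟩ : ∃ e ∈ atlas E M, c t ∈ e.source :=
    ⟨chartAt E (c t), chart_mem_atlas E (c t), mem_chart_source E (c t)⟩
  have h1 : ContinuousAt (fun z => F (chartTangent e z)) (chartLift e c t) :=
    (hF.continuousOn_chart he).continuousAt
      ((e.open_target.prod isOpen_univ).mem_nhds ⟨e.map_source hte, mem_univ _⟩)
  have h2 : ContinuousAt (fun s => F (chartTangent e (chartLift e c s))) t :=
    ContinuousAt.comp (g := fun z => F (chartTangent e z)) h1
      (hc.continuousAt_chartLift hJ he ht hte)
  refine h2.congr ?_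
  filter_upwards [hJ.mem_nhds ht,
    (hc.continuousAt hJ ht).eventually_mem (e.open_source.mem_nhds hte)] with s hs hs'
  rw [chartTangent_chartLift he (hc.mdifferentiableAt hJ hs) hs']

theorem IsGeodesicOn.speed_eq (hF : IsFinslerMetric F) (hc : IsGeodesicOn F c J)
    (hJ : IsOpen J) (hJc : IsPreconnected J) {t₁ t₂ : ℝ} (h₁ : t₁ ∈ J) (h₂ : t₂ ∈ J) :
    F (velocity c t₁) = F (velocity c t₂) := by
  -- the set where the speed has a given nonzero value is open and closed in `J`
  have key : ∀ t₁ ∈ J, F (velocity c t₁) ≠ 0 → ∀ t₂ ∈ J, F (velocity c t₁) = F (velocity c t₂) := by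
    intro t₁ h₁ hne t₂ h₂
    refine ((IsPreconnected.iff_of_locally_iff hJc
      (P := fun t => F (velocity c t₁) = F (velocity c t))
      ?_ h₁ h₂).1 rfl)
    intro t ht
    apply Filter.Eventually.filter_mono nhdsWithin_le_nhds
    have hcont := hc.continuousAt_speed hF hJ ht
    by_cases hP : F (velocity c t₁) = F (velocity c t)
    · have hev : ∀ᶠ s in 𝓝 t, HasDerivAt (fun s => 1 / 2 * F (velocity c s) ^ 2) 0 s := by
        filter_upwards [hcont.eventually_ne (hP ▸ hne), hJ.mem_nhds ht] with s hs hsJ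
        exact hc.hasDerivAt_speed hF hJ hsJ hs
      filter_upwards [eventually_eq_of_hasDerivAt_zero hev] with s hs
      have h3 : F (velocity c s) = F (velocity c t) := by
        rw [← sq_eq_sq₀ (hF.nonneg _) (hF.nonneg _)]; linarith
      rw [h3]
    · filter_upwards [hcont.eventually_ne (Ne.symm hP)] with s hs
      exact iff_of_false hs.symm hP
  by_cases h : F (velocity c t₁) = 0
  · by_contra hne
    have h2 : F (velocity c t₂) ≠ 0 := fun h2 => hne (h.trans h2.symm)
    exact hne (key t₂ h₂ h2 t₁ h₁).symm
  · exact key t₁ h₁ h t₂ h₂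

theorem IsGeodesicOn.eq_of_speed_zero [T2Space M] (hF : IsFinslerMetric F)
    (hc : IsGeodesicOn F c J) (hJ : IsOpen J) (hJc : IsPreconnected J) {t₁ t₂ : ℝ} (h₁ : t₁ ∈ J)
    (h₂ : t₂ ∈ J) (h0 : F (velocity c t₁) = 0) : c t₁ = c t₂ := by
  refine ((IsPreconnected.iff_of_locally_iff hJc (P := fun t => c t₁ = c t) ?_ h₁ h₂).1 rfl)
  intro t ht
  apply Filter.Eventually.filter_mono nhdsWithin_le_nhds
  obtain ⟨e, he, hte⟩ : ∃ e ∈ atlas E M, c t ∈ e.source :=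
    ⟨chartAt E (c t), chart_mem_atlas E (c t), mem_chart_source E (c t)⟩
  have hsrc := (hc.continuousAt hJ ht).eventually_mem (e.open_source.mem_nhds hte)
  have hev : ∀ᶠ s in 𝓝 t, HasDerivAt (e ∘ c) 0 s := by
    filter_upwards [hJ.mem_nhds ht, hsrc] with s hs hs'
    have h3 := hc.mdifferentiableAt hJ hs
    have h5 : (chartLift e c s).2 = 0 := by
      by_contra h6
      exact (hF.apply_ne_zero_iff _).2 ((velocity_snd_ne_zero_iff he h3 hs').1 h6)
        ((hc.speed_eq hF hJ hJc h₁ hs).symm.trans h0)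
    have h4 := (deriv_chart_comp he h3 hs').differentiableAt.hasDerivAt
    rwa [show deriv (e ∘ c) s = 0 from h5] at h4
  filter_upwards [eventually_eq_of_hasDerivAt_zero hev, hsrc] with s hs hs'
  rw [e.injOn hs' hte hs]

/-- Near `t`, the curve `c` has nonzero velocity and satisfies the Euler-Lagrange equations in the
chart `e`, in the form of a first order equation in phase space. -/
def SolvesInChartAt (F : TangentBundle 𝓘(ℝ, E) M → ℝ) (e : OpenPartialHomeomorph M E) (c : ℝ → M)
    (t : ℝ) : Prop :=
  ∀ᶠ s in 𝓝 t, c s ∈ e.source ∧ (chartLift e c s).2 ≠ 0 ∧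
    MDifferentiableAt 𝓘(ℝ, ℝ) 𝓘(ℝ, E) c s ∧
    HasDerivAt (chartLift e c) (lagrangianField (chartEnergy F e) (chartLift e c s)) s

theorem IsGeodesicOn.solvesInChartAt [FiniteDimensional ℝ E] (hF : IsFinslerMetric F)
    (hc : IsGeodesicOn F c J) (hJ : IsOpen J) (he : e ∈ atlas E M) {t : ℝ} (ht : t ∈ J)
    (hte : c t ∈ e.source) (hv : F (velocity c t) ≠ 0) : SolvesInChartAt F e c t := by
  have hv' := (velocity_snd_ne_zero_iff he (hc.mdifferentiableAt hJ ht) hte).2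
    ((hF.apply_ne_zero_iff _).1 hv)
  filter_upwards [hc.eventually_regular hJ he ht hte hv'] with s hs
  exact ⟨hs.2.1, hs.2.2, hc.mdifferentiableAt hJ hs.1,
    hc.hasDerivAt_field hF hJ he hs.1 hs.2.1 hs.2.2⟩

theorem chartLift_eq_of_velocity_eq (he : e ∈ atlas E M) {c₁ c₂ : ℝ → M} {t₁ t₂ : ℝ}
    (h₁ : MDifferentiableAt 𝓘(ℝ, ℝ) 𝓘(ℝ, E) c₁ t₁) (h₂ : MDifferentiableAt 𝓘(ℝ, ℝ) 𝓘(ℝ, E) c₂ t₂)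
    (hs : c₁ t₁ ∈ e.source)
    (h : (velocity c₁ t₁ : TangentBundle 𝓘(ℝ, E) M) = velocity c₂ t₂) :
    chartLift e c₁ t₁ = chartLift e c₂ t₂ := by
  have hp : c₁ t₁ = c₂ t₂ := congrArg Bundle.TotalSpace.proj h
  have key : ∀ (c : ℝ → M) (t : ℝ), MDifferentiableAt 𝓘(ℝ, ℝ) 𝓘(ℝ, E) c t → c t ∈ e.source →
      chartLift e c t = (fun p : TangentBundle 𝓘(ℝ, E) M =>
        ((e p.1, mfderiv 𝓘(ℝ, E) 𝓘(ℝ, E) e p.1 p.2) : E × E)) (velocity c t) := by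
    intro c t hc ht
    exact Prod.ext rfl (deriv_chart_comp he hc ht).deriv
  rw [key c₁ t₁ h₁ hs, key c₂ t₂ h₂ (hp ▸ hs), h]

theorem velocity_eq_of_chartLift_eq (he : e ∈ atlas E M) {c₁ c₂ : ℝ → M} {t₁ t₂ : ℝ}
    (h₁ : MDifferentiableAt 𝓘(ℝ, ℝ) 𝓘(ℝ, E) c₁ t₁) (h₂ : MDifferentiableAt 𝓘(ℝ, ℝ) 𝓘(ℝ, E) c₂ t₂)
    (hs₁ : c₁ t₁ ∈ e.source) (hs₂ : c₂ t₂ ∈ e.source)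
    (h : chartLift e c₁ t₁ = chartLift e c₂ t₂) :
    (velocity c₁ t₁ : TangentBundle 𝓘(ℝ, E) M) = velocity c₂ t₂ := by
  rw [← chartTangent_chartLift he h₁ hs₁, ← chartTangent_chartLift he h₂ hs₂, h]

/-- Uniqueness of geodesics. Of the second curve the Euler-Lagrange equations are required near
each time in one chart only. -/
theorem IsGeodesicOn.velocity_eq [FiniteDimensional ℝ E] [T2Space M] (hF : IsFinslerMetric F)
    {c₁ c₂ : ℝ → M} (hc₁ : IsGeodesicOn F c₁ J) (hJ : IsOpen J) (hJc : IsPreconnected J)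
    (hc₂ : ∀ t ∈ J, ∃ e ∈ atlas E M, SolvesInChartAt F e c₂ t) {t₁ t₂ : ℝ} (h₁ : t₁ ∈ J)
    (h₂ : t₂ ∈ J) (h : (velocity c₁ t₁ : TangentBundle 𝓘(ℝ, E) M) = velocity c₂ t₁) :
    (velocity c₁ t₂ : TangentBundle 𝓘(ℝ, E) M) = velocity c₂ t₂ := by
  have := FiniteDimensional.complete ℝ E
  refine ((IsPreconnected.iff_of_locally_iff hJc
    (P := fun t => (velocity c₁ t : TangentBundle 𝓘(ℝ, E) M) = velocity c₂ t) ?_ h₁ h₂).1 h)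
  intro t ht
  apply Filter.Eventually.filter_mono nhdsWithin_le_nhds
  obtain ⟨e, he, hsol⟩ := hc₂ t ht
  obtain ⟨hte, hv, hmd, hd⟩ := hsol.self_of_nhds
  by_cases hP : (velocity c₁ t : TangentBundle 𝓘(ℝ, E) M) = velocity c₂ t
  · have hp : c₁ t = c₂ t := congrArg Bundle.TotalSpace.proj hP
    have hte₁ : c₁ t ∈ e.source := hp ▸ hte
    have hlift := chartLift_eq_of_velocity_eq he (hc₁.mdifferentiableAt hJ ht) hmd hte₁ hP
    have hv₁ : F (velocity c₁ t) ≠ 0 := by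
      rw [hP]
      exact (hF.apply_ne_zero_iff _).2 ((velocity_snd_ne_zero_iff he hmd hte).1 hv)
    have hsol₁ := hc₁.solvesInChartAt hF hJ he ht hte₁ hv₁
    have hfield := contDiffAt_lagrangianField (hF.contDiffAt_chartEnergy he (e.map_source hte) hv)
      (hF.fibreHessian_pos he (e.map_source hte) hv)
    obtain ⟨K, U, hU, hK⟩ := (hfield.of_le (m := 1) (by norm_cast)).exists_lipschitzOnWith
    have heq : chartLift e c₁ =ᶠ[𝓝 t] chartLift e c₂ := by
      refine ODE_solution_unique_of_eventually
        (v := fun _ => lagrangianField (chartEnergy F e)) (s := fun _ => U) (K := K)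
        (.of_forall fun _ => hK) ?_ ?_ hlift
      · filter_upwards [hsol₁, hsol₁.self_of_nhds.2.2.2.continuousAt.eventually_mem (hlift ▸ hU)]
          with s hs hs' using ⟨hs.2.2.2, hs'⟩
      · filter_upwards [hsol, hd.continuousAt.eventually_mem hU]
          with s hs hs' using ⟨hs.2.2.2, hs'⟩
    filter_upwards [heq, hsol, hsol₁] with s hs hs₂ hs₁
    exact iff_of_true (velocity_eq_of_chartLift_eq he hs₁.2.2.1 hs₂.2.2.1 hs₁.1 hs₂.1 hs) hP
  · by_cases hp : c₁ t = c₂ t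
    · have hte₁ : c₁ t ∈ e.source := hp ▸ hte
      have hne : chartLift e c₁ t ≠ chartLift e c₂ t := fun hl =>
        hP (velocity_eq_of_chartLift_eq he (hc₁.mdifferentiableAt hJ ht) hmd hte₁ hte hl)
      filter_upwards [hsol, hJ.mem_nhds ht,
        (hc₁.continuousAt hJ ht).eventually_mem (e.open_source.mem_nhds hte₁),
        eventually_ne_of_continuousAt (hc₁.continuousAt_chartLift hJ he ht hte₁)
          hd.continuousAt hne]
        with s hs hsJ hse hsne
      exact iff_of_false (fun h' => hsne (chartLift_eq_of_velocity_eq he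
        (hc₁.mdifferentiableAt hJ hsJ) hs.2.2.1 hse h')) hP
    · filter_upwards [eventually_ne_of_continuousAt (hc₁.continuousAt hJ ht) hmd.continuousAt hp]
        with s hs
      exact iff_of_false (fun h' => hs (congrArg Bundle.TotalSpace.proj h')) hP

/-- Two geodesics with the same initial vector agree at time one. -/
theorem IsGeodesicFrom.apply_one_eq [FiniteDimensional ℝ E] [T2Space M] (hF : IsFinslerMetric F)
    {x : M} {X : E} {c₁ c₂ : ℝ → M} (h₁ : IsGeodesicFrom F x X c₁) (h₂ : IsGeodesicFrom F x X c₂) :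
    c₁ 1 = c₂ 1 := by
  obtain ⟨hv₁, δ₁, hδ₁, hg₁⟩ := h₁
  obtain ⟨hv₂, δ₂, hδ₂, hg₂⟩ := h₂
  have hp : c₁ 0 = c₂ 0 := congrArg Bundle.TotalSpace.proj (hv₁.trans hv₂.symm)
  have h0 : ∀ δ : ℝ, 0 < δ → (0 : ℝ) ∈ Ioo (-δ) (1 + δ) := fun δ h => ⟨by linarith, by linarith⟩
  have h1 : ∀ δ : ℝ, 0 < δ → (1 : ℝ) ∈ Ioo (-δ) (1 + δ) := fun δ h => ⟨by linarith, by linarith⟩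
  rcases eq_or_ne X 0 with rfl | hX
  · rw [← hg₁.eq_of_speed_zero hF isOpen_Ioo isPreconnected_Ioo (h0 _ hδ₁) (h1 _ hδ₁)
        (by rw [hv₁, hF.apply_zero]),
      ← hg₂.eq_of_speed_zero hF isOpen_Ioo isPreconnected_Ioo (h0 _ hδ₂) (h1 _ hδ₂)
        (by rw [hv₂, hF.apply_zero]), hp]
  · have hJ : IsOpen (Ioo (-(min δ₁ δ₂)) (1 + min δ₁ δ₂)) := isOpen_Ioo
    have hsub₁ : Ioo (-(min δ₁ δ₂)) (1 + min δ₁ δ₂) ⊆ Ioo (-δ₁) (1 + δ₁) :=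
      Ioo_subset_Ioo (by simp) (by simp)
    have hsub₂ : Ioo (-(min δ₁ δ₂)) (1 + min δ₁ δ₂) ⊆ Ioo (-δ₂) (1 + δ₂) :=
      Ioo_subset_Ioo (by simp) (by simp)
    have hg₁' : IsGeodesicOn F c₁ (Ioo (-(min δ₁ δ₂)) (1 + min δ₁ δ₂)) :=
      ⟨hg₁.1.mono hsub₁, fun e he t ht => hg₁.2 e he t (hsub₁ ht)⟩
    have hpos := lt_min hδ₁ hδ₂
    have := hg₁'.velocity_eq hF hJ isPreconnected_Ioo (c₂ := c₂) (t₁ := 0) (t₂ := 1) ?_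
      (h0 _ hpos) (h1 _ hpos) (hv₁.trans hv₂.symm)
    · exact congrArg Bundle.TotalSpace.proj this
    · intro t ht
      refine ⟨chartAt E (c₂ t), chart_mem_atlas E (c₂ t), hg₂.solvesInChartAt hF isOpen_Ioo
        (chart_mem_atlas E (c₂ t)) (hsub₂ ht) (mem_chart_source E (c₂ t)) ?_⟩
      rw [hg₂.speed_eq hF isOpen_Ioo isPreconnected_Ioo (hsub₂ ht) (h0 _ hδ₂), hv₂]
      exact (hF.pos x X hX).ne'

theorem IsGeodesicFrom.expMap_eq [FiniteDimensional ℝ E] [T2Space M] (hF : IsFinslerMetric F)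
    {x : M} {X : E} (h : IsGeodesicFrom F x X c) : expMap F x X = c 1 := by
  have hex : ∃ c : ℝ → M, IsGeodesicFrom F x X c := ⟨c, h⟩
  unfold expMap
  rw [dif_pos hex]
  exact hex.choose_spec.apply_one_eq hF h

theorem fderiv_smul_of_homogeneous {G : Type*} [NormedAddCommGroup G] [NormedSpace ℝ G]
    {f : E → G} {a : ℝ} (ha : a ≠ 0) (hf : ∀ v, f (a • v) = a ^ 2 • f v) (v : E) :
    fderiv ℝ f (a • v) = a • fderiv ℝ f v := by
  have h1 := fderiv_comp_smul (f := f) (x := v) a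
  have h2 : (fun v => f (a • v)) = a ^ 2 • f := funext hf
  rw [h2, fderiv_const_smul_field, sq, mul_smul] at h1
  exact (smul_right_injective _ ha h1).symm

theorem IsFinslerMetric.chartLagrangian_smul (hF : IsFinslerMetric F) (q v : E) {a : ℝ}
    (ha : 0 ≤ a) : chartLagrangian F e q (a • v) = a ^ 2 • chartLagrangian F e q v := by
  change 1 / 2 * F (chartTangent e (q, a • v)) ^ 2 = a ^ 2 * (1 / 2 * F (chartTangent e (q, v)) ^ 2)
  rw [hF.chartTangent_smul q v ha]
  ring

theorem IsGeodesicOn.comp_mul (hF : IsFinslerMetric F) (hc : IsGeodesicOn F c J) {a : ℝ}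
    (ha : 0 < a) : IsGeodesicOn F (fun t => c (a * t)) ((fun t => a * t) ⁻¹' J) := by
  refine ⟨hc.1.comp (contDiff_const.mul contDiff_id).contMDiff.contMDiffOn subset_rfl, ?_⟩
  intro e he t ht hte
  have hderiv : ∀ s, deriv (e ∘ fun t => c (a * t)) s = a • deriv (e ∘ c) (a * s) := fun s =>
    deriv_comp_mul_left a (e ∘ c) s
  have h1 := hc.2 e he (a * t) ht hte
  have h2 : ∀ s, fderiv ℝ (fun v => chartLagrangian F e (e (c (a * s))) v)
      (deriv (e ∘ fun t => c (a * t)) s) =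
        a • fderiv ℝ (fun v => chartLagrangian F e (e (c (a * s))) v) (deriv (e ∘ c) (a * s)) := by
    intro s
    rw [hderiv]
    exact fderiv_smul_of_homogeneous ha.ne' (fun v => hF.chartLagrangian_smul _ v ha.le) _
  have h3 : (fun q => chartLagrangian F e q (deriv (e ∘ fun t => c (a * t)) t)) =
      a ^ 2 • fun q => chartLagrangian F e q (deriv (e ∘ c) (a * t)) := by
    funext q
    rw [hderiv]
    exact hF.chartLagrangian_smul _ _ ha.le
  simp only [h2, h3]
  rw [fderiv_const_smul_field, sq, mul_smul]
  have h4 := (h1.scomp t (((hasDerivAt_id t).const_mul a))).const_smul a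
  rw [mul_one] at h4
  exact h4

theorem velocity_comp {τ : ℝ → ℝ} {τ' s : ℝ} (hτ : HasDerivAt τ τ' s)
    (hc : MDifferentiableAt 𝓘(ℝ, ℝ) 𝓘(ℝ, E) c (τ s)) :
    (velocity (fun s => c (τ s)) s : TangentBundle 𝓘(ℝ, E) M) =
      ⟨c (τ s), (τ' • (velocity c (τ s) : TangentBundle 𝓘(ℝ, E) M).2 : E)⟩ := by
  have h2 := (hc.hasMFDerivAt.comp s hτ.hasFDerivAt.hasMFDerivAt).mfderiv
  have h3 : (mfderiv 𝓘(ℝ, ℝ) 𝓘(ℝ, E) (fun s => c (τ s)) s : ℝ →L[ℝ] E) 1 =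
      (mfderiv 𝓘(ℝ, ℝ) 𝓘(ℝ, E) c (τ s) : ℝ →L[ℝ] E) ((1 : ℝ) • τ') :=
    DFunLike.congr_fun h2 (1 : ℝ)
  have key : ∀ A : ℝ →L[ℝ] E, A ((1 : ℝ) • τ') = τ' • A 1 := fun A => by
    rw [← map_smul, smul_eq_mul, smul_eq_mul, mul_comm]
  exact congrArg (fun v : E => (⟨c (τ s), v⟩ : TangentBundle 𝓘(ℝ, E) M)) (h3.trans (key _))

theorem IsGeodesicFrom.comp_mul (hF : IsFinslerMetric F) {x : M} {X : E} {δ : ℝ} (hδ : 0 < δ)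
    (h0 : velocity c 0 = (⟨x, X⟩ : TangentBundle 𝓘(ℝ, E) M))
    (hc : IsGeodesicOn F c (Ioo (-δ) (1 + δ))) {a : ℝ} (ha : a ∈ Ioo 0 (1 + δ)) :
    IsGeodesicFrom F x (a • X) (fun t => c (a * t)) := by
  refine ⟨?_, min (δ / a) ((1 + δ) / a - 1), ?_, ?_⟩
  · have h0mem : a * 0 ∈ Ioo (-δ) (1 + δ) := by rw [mul_zero]; exact ⟨by linarith, by linarith⟩
    have hτ : HasDerivAt (fun t : ℝ => a * t) a 0 := by
      simpa using (hasDerivAt_id (0 : ℝ)).const_mul a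
    rw [velocity_comp hτ (hc.mdifferentiableAt isOpen_Ioo h0mem), mul_zero, h0,
      show c 0 = x from congrArg Bundle.TotalSpace.proj h0]
    rfl
  · refine lt_min (div_pos hδ ha.1) ?_
    rw [sub_pos, lt_div_iff₀ ha.1]
    linarith [ha.2]
  · have h1 := hc.comp_mul hF ha.1
    have hsub : Ioo (-(min (δ / a) ((1 + δ) / a - 1))) (1 + min (δ / a) ((1 + δ) / a - 1)) ⊆
        (fun t => a * t) ⁻¹' Ioo (-δ) (1 + δ) := by
      rintro t ⟨ht1, ht2⟩
      have h3 := min_le_left (δ / a) ((1 + δ) / a - 1)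
      have h4 := min_le_right (δ / a) ((1 + δ) / a - 1)
      have h5 : -(δ / a) < t := by linarith
      have h6 : t < (1 + δ) / a := by linarith
      rw [lt_div_iff₀ ha.1] at h6
      rw [← neg_div, div_lt_iff₀ ha.1] at h5
      exact ⟨by linarith, by linarith⟩
    exact ⟨h1.1.mono hsub, fun e he t ht => h1.2 e he t (hsub ht)⟩

theorem isGeodesicFrom_const (hF : IsFinslerMetric F) (x : M) :
    IsGeodesicFrom F x (0 : E) (fun _ => x) := by
  refine ⟨?_, 1, one_pos, contMDiffOn_const, fun e he t ht hte => ?_⟩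
  · unfold velocity
    rw [mfderiv_const]
    rfl
  · have h1 : ∀ s, deriv (e ∘ fun _ : ℝ => x) s = 0 := fun s => deriv_const s (e x)
    have h2 : (fun q => chartLagrangian F e q (0 : E)) = fun _ => 0 := by
      funext q
      simpa using hF.chartLagrangian_smul (e := e) q (0 : E) le_rfl
    simp only [h1, h2]
    simpa using hasDerivAt_const t (fderiv ℝ (fun v => chartLagrangian F e (e x) v) 0)

/-- The exponential map on the line through `X` follows the geodesic with initial vector `X`. -/
theorem IsGeodesicOn.expMap_smul [FiniteDimensional ℝ E] [T2Space M] (hF : IsFinslerMetric F)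
    {x : M} {X : E} {δ : ℝ} (hδ : 0 < δ)
    (h0 : velocity c 0 = (⟨x, X⟩ : TangentBundle 𝓘(ℝ, E) M))
    (hc : IsGeodesicOn F c (Ioo (-δ) (1 + δ))) {a : ℝ} (ha : a ∈ Ico 0 (1 + δ)) :
    expMap F x (a • X) = c a := by
  rcases ha.1.eq_or_lt with rfl | hpos
  · rw [zero_smul, (isGeodesicFrom_const hF x).expMap_eq hF]
    exact (congrArg Bundle.TotalSpace.proj h0).symm
  · rw [(IsGeodesicFrom.comp_mul hF hδ h0 hc ⟨hpos, ha.2⟩).expMap_eq hF, mul_one]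

end Geodesics

/-! ### Variations of geodesics and the Gauss lemma -/

section Variation

variable {E : Type*} [NormedAddCommGroup E] [NormedSpace ℝ E]
  {M : Type*} [TopologicalSpace M] [ChartedSpace E M] [IsManifold 𝓘(ℝ, E) ∞ M]
  {F : TangentBundle 𝓘(ℝ, E) M → ℝ} {e : OpenPartialHomeomorph M E}

/-- A curve in `M` obtained from an integral curve of the Euler-Lagrange field in a chart. -/
theorem solvesInChartAt_symm_comp (he : e ∈ atlas E M) {η : ℝ → E × E} {I : Set ℝ} (hI : IsOpen I)
    (hη : ∀ t ∈ I, HasDerivAt η (lagrangianField (chartEnergy F e) (η t)) t)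
    (hmem : ∀ t ∈ I, η t ∈ e.target ×ˢ ({0}ᶜ : Set E)) {t : ℝ} (ht : t ∈ I) :
    chartLift e (fun t => e.symm (η t).1) t = η t ∧
      SolvesInChartAt F e (fun t => e.symm (η t).1) t := by
  have hfst : ∀ s ∈ I, HasDerivAt (fun t => (η t).1) (η s).2 s := fun s hs =>
    (hasFDerivAt_fst (𝕜 := ℝ) (E := E) (F := E) (p := η s)).comp_hasDerivAt s (hη s hs)
  have hlift : ∀ s ∈ I, chartLift e (fun t => e.symm (η t).1) s = η s := by
    intro s hs
    have h1 : (e ∘ fun t => e.symm (η t).1) =ᶠ[𝓝 s] fun t => (η t).1 := by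
      filter_upwards [hI.mem_nhds hs] with r hr using e.right_inv (hmem r hr).1
    exact Prod.ext (e.right_inv (hmem s hs).1) (h1.deriv_eq.trans (hfst s hs).deriv)
  refine ⟨hlift t ht, ?_⟩
  filter_upwards [hI.mem_nhds ht] with s hs
  refine ⟨e.map_target (hmem s hs).1, ?_, ?_, ?_⟩
  · rw [hlift s hs]; exact (hmem s hs).2
  · exact ((mdifferentiable_of_mem_atlas (I := 𝓘(ℝ, E)) he).mdifferentiableAt_symm
      (hmem s hs).1).comp s (hfst s hs).differentiableAt.mdifferentiableAt
  · rw [hlift s hs]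
    refine (hη s hs).congr_of_eventuallyEq ?_
    filter_upwards [hI.mem_nhds hs] with r hr using hlift r hr

/-- In the coordinates of `e`, the velocities at time `t` of the curves `γ s` depend on `s`
differentiably at `s₀`. -/
def LiftDifferentiableAt (e : OpenPartialHomeomorph M E) (γ : ℝ → ℝ → M) (s₀ t : ℝ) : Prop :=
  (∀ᶠ s in 𝓝 s₀, γ s t ∈ e.source ∧ MDifferentiableAt 𝓘(ℝ, ℝ) 𝓘(ℝ, E) (γ s) t) ∧
    DifferentiableAt ℝ (fun s => chartLift e (γ s) t) s₀

/-- Differentiability of the lifts does not depend on the chart. -/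
theorem LiftDifferentiableAt.change_chart {γ : ℝ → ℝ → M} {s₀ t : ℝ} (he : e ∈ atlas E M)
    (h : LiftDifferentiableAt e γ s₀ t) {e' : OpenPartialHomeomorph M E} (he' : e' ∈ atlas E M)
    (ht : γ s₀ t ∈ e'.source) : LiftDifferentiableAt e' γ s₀ t := by
  obtain ⟨hev, hd⟩ := h
  have hs₀ := hev.self_of_nhds.1
  have hq : DifferentiableAt ℝ (fun s => e (γ s t)) s₀ := hd.fst
  have hsrc : ∀ᶠ s in 𝓝 s₀, γ s t ∈ e'.source := by
    have h1 : ContinuousAt (fun s => e.symm (e (γ s t))) s₀ :=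
      ContinuousAt.comp (g := e.symm) (f := fun s => e (γ s t))
        (e.continuousAt_symm (e.map_source hs₀)) hq.continuousAt
    filter_upwards [h1.eventually_mem (e'.open_source.mem_nhds
      (by rw [e.left_inv hs₀]; exact ht)), hev] with s hs hs'
    rwa [e.left_inv hs'.1] at hs
  -- the transition map and the induced transition map of velocities
  have hφ : ContDiffAt ℝ ∞ (e' ∘ e.symm) (e (γ s₀ t)) := by
    rw [← contMDiffAt_iff_contDiffAt]
    refine ContMDiffAt.comp _ (contMDiffAt_of_mem_maximalAtlas (I := 𝓘(ℝ, E))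
      (IsManifold.subset_maximalAtlas he') (by rwa [e.left_inv hs₀])) ?_
    exact contMDiffAt_symm_of_mem_maximalAtlas (IsManifold.subset_maximalAtlas he)
      (e.map_source hs₀)
  have hΨ : DifferentiableAt ℝ (fun z : E × E =>
      ((e' ∘ e.symm) z.1, fderiv ℝ (e' ∘ e.symm) z.1 z.2))
      (chartLift e (γ s₀) t) := by
    have h1 : DifferentiableAt ℝ (fun z : E × E => (e' ∘ e.symm) z.1) (chartLift e (γ s₀) t) :=
      DifferentiableAt.comp (g := e' ∘ e.symm) (chartLift e (γ s₀) t)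
        (hφ.differentiableAt (by simp)) differentiableAt_fst
    have h2 : DifferentiableAt ℝ (fun z : E × E => fderiv ℝ (e' ∘ e.symm) z.1)
        (chartLift e (γ s₀) t) :=
      ((hφ.fderiv_right (m := 1) (by norm_cast)).differentiableAt (by norm_num)).comp
        (chartLift e (γ s₀) t) differentiableAt_fst
    exact h1.prodMk (h2.clm_apply differentiableAt_snd)
  refine ⟨(hsrc.and hev).mono fun s hs => ⟨hs.1, hs.2.2⟩, ?_⟩
  have hφd : ∀ᶠ s in 𝓝 s₀, DifferentiableAt ℝ (e' ∘ e.symm) (e (γ s t)) := by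
    refine hq.continuousAt.eventually (p := fun y => DifferentiableAt ℝ (e' ∘ e.symm) y) ?_
    filter_upwards [(hφ.of_le (m := 1) (by norm_cast)).eventually (by simp)] with y hy
    exact hy.differentiableAt (by norm_num)
  refine (hΨ.comp s₀ hd).congr_of_eventuallyEq ?_
  filter_upwards [hev, hφd] with s hs hsφ
  have h1 : (e' ∘ γ s) =ᶠ[𝓝 t] (e' ∘ e.symm) ∘ (e ∘ γ s) := by
    filter_upwards [hs.2.continuousAt.eventually_mem (e.open_source.mem_nhds hs.1)] with r hr
    simp [e.left_inv hr]
  have h2 := (deriv_chart_comp he hs.2 hs.1).differentiableAt.hasDerivAt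
  refine Prod.ext ?_ ?_
  · simp [chartLift, e.left_inv hs.1]
  · exact h1.deriv_eq.trans (hsφ.hasFDerivAt.comp_hasDerivAt t h2).deriv

/-- A family of geodesics `γ s`, for `s` near `s₀`, that start at `x` with the nonzero velocities
`β s`, where `β` has the derivative `β'` at `s₀`. -/
structure IsGeodesicVariation (F : TangentBundle 𝓘(ℝ, E) M → ℝ) (x : M) (β : ℝ → E) (β' : E)
    (γ : ℝ → ℝ → M) (s₀ : ℝ) : Prop where
  geodesic : ∀ᶠ s in 𝓝 s₀, β s ≠ 0 ∧ IsGeodesicFrom F x (β s) (γ s)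
  hasDerivAt : HasDerivAt β β' s₀

variable {x : M} {β : ℝ → E} {β' : E} {γ : ℝ → ℝ → M} {s₀ : ℝ}

theorem IsGeodesicFrom.exists_isGeodesicOn {X : E} {c : ℝ → M} (h : IsGeodesicFrom F x X c) :
    ∃ δ : ℝ, 0 < δ ∧ IsGeodesicOn F c (Ioo (-δ) (1 + δ)) ∧ Icc 0 1 ⊆ Ioo (-δ) (1 + δ) := by
  obtain ⟨_, δ, hδ, hg⟩ := h
  exact ⟨δ, hδ, hg, fun t ht => ⟨by linarith [ht.1], by linarith [ht.2]⟩⟩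

theorem IsGeodesicFrom.speed_eq (hF : IsFinslerMetric F) {X : E} {c : ℝ → M}
    (h : IsGeodesicFrom F x X c) {t : ℝ} (ht : t ∈ Icc (0 : ℝ) 1) :
    F (velocity c t) = F ⟨x, X⟩ := by
  obtain ⟨δ, hδ, hg, hsub⟩ := h.exists_isGeodesicOn
  rw [hg.speed_eq hF isOpen_Ioo isPreconnected_Ioo (hsub ht) (hsub (left_mem_Icc.2 zero_le_one)),
    h.1]

theorem IsGeodesicFrom.mdifferentiableAt {X : E} {c : ℝ → M} (h : IsGeodesicFrom F x X c) {t : ℝ}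
    (ht : t ∈ Icc (0 : ℝ) 1) : MDifferentiableAt 𝓘(ℝ, ℝ) 𝓘(ℝ, E) c t := by
  obtain ⟨δ, hδ, hg, hsub⟩ := h.exists_isGeodesicOn
  exact hg.mdifferentiableAt isOpen_Ioo (hsub ht)

/-- The linearised Euler-Lagrange field still has the velocity as its first component. -/
theorem fst_fderiv_lagrangianField {L : E × E → ℝ} {z : E × E}
    (hL : DifferentiableAt ℝ (lagrangianField L) z) (w : E × E) :
    (fderiv ℝ (lagrangianField L) z w).1 = w.2 := by
  have h1 := (hasFDerivAt_fst (𝕜 := ℝ) (p := lagrangianField L z)).comp z hL.hasFDerivAt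
  have h2 : HasFDerivAt (Prod.fst ∘ lagrangianField L) (ContinuousLinearMap.snd ℝ E E) z :=
    hasFDerivAt_snd
  exact DFunLike.congr_fun (h1.unique h2) w

/-- Near each time, differentiability in `s` of the variation propagates along the flow of the
Euler-Lagrange field, and the variation field `W` has as velocity the variation of the velocity. -/
theorem IsGeodesicVariation.exists_variation_field [FiniteDimensional ℝ E] [T2Space M]
    (hF : IsFinslerMetric F) (h : IsGeodesicVariation F x β β' γ s₀) {tc : ℝ}
    (htc : tc ∈ Icc (0 : ℝ) 1) :
    ∃ e ∈ atlas E M, ∃ ε > 0, ∀ t₁ ∈ Icc (0 : ℝ) 1 ∩ Metric.ball tc ε,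
      γ s₀ t₁ ∈ e.source ∧ (LiftDifferentiableAt e γ s₀ t₁ → ∃ W : ℝ → E × E,
        ∀ t ∈ Metric.ball tc ε, HasDerivAt (fun t => (W t).1) (W t).2 t ∧
          (t ∈ Icc (0 : ℝ) 1 → LiftDifferentiableAt e γ s₀ t ∧
            HasDerivAt (fun s => chartLift e (γ s) t) (W t) s₀)) := by
  have := FiniteDimensional.complete ℝ E
  obtain ⟨e, he, htce⟩ : ∃ e ∈ atlas E M, γ s₀ tc ∈ e.source :=
    ⟨chartAt E (γ s₀ tc), chart_mem_atlas E _, mem_chart_source E _⟩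
  obtain ⟨hβ, hγ⟩ := h.geodesic.self_of_nhds
  obtain ⟨δ, hδ, hg, hsub⟩ := hγ.exists_isGeodesicOn
  have hv : F (velocity (γ s₀) tc) ≠ 0 := by
    rw [hγ.speed_eq hF htc]; exact (hF.pos x _ hβ).ne'
  have hsol := hg.solvesInChartAt hF isOpen_Ioo he (hsub htc) htce hv
  obtain ⟨-, hv0, -, hd0⟩ := hsol.self_of_nhds
  have hN : e.target ×ˢ ({0}ᶜ : Set E) ∈ 𝓝 (chartLift e (γ s₀) tc) :=
    (e.open_target.prod isOpen_compl_singleton).mem_nhds ⟨e.map_source htce, hv0⟩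
  have hreg : ∀ z ∈ e.target ×ˢ ({0}ᶜ : Set E),
      ContDiffAt ℝ ∞ (lagrangianField (chartEnergy F e)) z := fun z hz =>
    contDiffAt_lagrangianField (hF.contDiffAt_chartEnergy he hz.1 hz.2)
      (hF.fibreHessian_pos he hz.1 hz.2)
  obtain ⟨ε₀, hε₀, V, hV, Φ, hΦ, hW⟩ :=
    exists_local_flow ((hreg _ (mem_of_mem_nhds hN)).of_le (by norm_cast)) hN
  obtain ⟨ε₁, hε₁, hball⟩ := Metric.eventually_nhds_iff_ball.1
    (hsol.and (hd0.continuousAt.eventually_mem (interior_mem_nhds.2 hV)))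
  refine ⟨e, he, min ε₁ (ε₀ / 2), lt_min hε₁ (by linarith), ?_⟩
  rintro t₁ ⟨ht₁, ht₁b⟩
  have hb1 : ∀ t ∈ Metric.ball tc (min ε₁ (ε₀ / 2)), t ∈ Metric.ball tc ε₁ :=
    fun t ht => Metric.ball_subset_ball (min_le_left _ _) ht
  have hb2 : ∀ t ∈ Metric.ball tc (min ε₁ (ε₀ / 2)), t - t₁ ∈ Ioo (-ε₀) ε₀ := by
    intro t ht
    have h1 := Metric.ball_subset_ball (min_le_right ε₁ (ε₀ / 2)) ht
    have h2 := Metric.ball_subset_ball (min_le_right ε₁ (ε₀ / 2)) ht₁b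
    rw [Metric.mem_ball, Real.dist_eq, abs_lt] at h1 h2
    exact ⟨by linarith [h1.1, h2.2], by linarith [h1.2, h2.1]⟩
  have hV₁ : chartLift e (γ s₀) t₁ ∈ interior V := (hball t₁ (hb1 t₁ ht₁b)).2
  refine ⟨(hball t₁ (hb1 t₁ ht₁b)).1.1, fun hlift => ?_⟩
  obtain ⟨hev, hdiff⟩ := hlift
  obtain ⟨W, hW0, hWd, hWΦ⟩ := hW _ (interior_subset hV₁)
    (deriv (fun s => chartLift e (γ s) t₁) s₀)
  refine ⟨fun t => W (t - t₁), fun t ht => ⟨?_, fun ht01 => ?_⟩⟩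
  · have h1 := (hWd (t - t₁) (hb2 t ht)).comp_sub_const t t₁
    have h2 := (hasFDerivAt_fst (𝕜 := ℝ)).comp_hasDerivAt t h1
    have hz := ((hΦ _ (interior_subset hV₁)).2 (t - t₁) (hb2 t ht)).1
    have h3 := fst_fderiv_lagrangianField ((hreg _ hz).differentiableAt (by simp)) (W (t - t₁))
    rw [← h3]
    exact h2
  · -- by uniqueness, the nearby geodesics are given by the local flow
    have hγΦ : ∀ᶠ s in 𝓝 s₀, γ s t ∈ e.source ∧ MDifferentiableAt 𝓘(ℝ, ℝ) 𝓘(ℝ, E) (γ s) t ∧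
        chartLift e (γ s) t = Φ (chartLift e (γ s) t₁) (t - t₁) := by
      filter_upwards [h.geodesic, hev, hdiff.continuousAt.eventually_mem
        (isOpen_interior.mem_nhds hV₁)] with s hs hs₁ hsV
      have hΦs := hΦ _ (interior_subset hsV)
      obtain ⟨δ', hδ', hg', hsub'⟩ := hs.2.exists_isGeodesicOn
      set η : ℝ → E × E := fun r => Φ (chartLift e (γ s) t₁) (r - t₁) with hη
      set I : Set ℝ := (fun r => r - t₁) ⁻¹' Ioo (-ε₀) ε₀ with hI
      have hIo : IsOpen I := isOpen_Ioo.preimage (by fun_prop)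
      have hIeq : I = Ioo (-ε₀ + t₁) (ε₀ + t₁) := by simp [hI]
      have hηd : ∀ r ∈ I, HasDerivAt η (lagrangianField (chartEnergy F e) (η r)) r := fun r hr =>
        (hΦs.2 (r - t₁) hr).2.comp_sub_const r t₁
      have hηm : ∀ r ∈ I, η r ∈ e.target ×ˢ ({0}ᶜ : Set E) := fun r hr => (hΦs.2 (r - t₁) hr).1
      have hchart := fun r hr => solvesInChartAt_symm_comp he hIo hηd hηm (t := r) hr
      have ht₁I : t₁ ∈ I := by simp [hI, hε₀]
      have hη₁ : η t₁ = chartLift e (γ s) t₁ := by simp [hη, hΦs.1]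
      have hgJ : IsGeodesicOn F (γ s) (Ioo (-δ') (1 + δ') ∩ I) :=
        ⟨hg'.1.mono inter_subset_left, fun e he t ht => hg'.2 e he t ht.1⟩
      have hJc : IsPreconnected (Ioo (-δ') (1 + δ') ∩ I) := by
        rw [hIeq, Ioo_inter_Ioo]; exact isPreconnected_Ioo
      have hmd₁ := (hchart t₁ ht₁I).2.self_of_nhds
      have hvel := hgJ.velocity_eq hF (isOpen_Ioo.inter hIo) hJc
        (c₂ := fun r => e.symm (η r).1) (fun r hr => ⟨e, he, (hchart r hr.2).2⟩)
        (t₁ := t₁) (t₂ := t) ⟨hsub' ht₁, ht₁I⟩ ⟨hsub' ht01, hb2 t ht⟩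
        (velocity_eq_of_chartLift_eq he hs₁.2 hmd₁.2.2.1 hs₁.1 hmd₁.1
          (by rw [(hchart t₁ ht₁I).1, hη₁]))
      have hmd := (hchart t (hb2 t ht)).2.self_of_nhds
      have hpt : γ s t = e.symm (η t).1 := congrArg Bundle.TotalSpace.proj hvel
      have hsrc : γ s t ∈ e.source := hpt ▸ hmd.1
      have hmdγ := hs.2.mdifferentiableAt ht01
      refine ⟨hsrc, hmdγ, ?_⟩
      rw [chartLift_eq_of_velocity_eq he hmdγ hmd.2.2.1 hsrc hvel, (hchart t (hb2 t ht)).1]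
    have hd := hWΦ (fun s => chartLift e (γ s) t₁) s₀ rfl hdiff.hasDerivAt (t - t₁) (hb2 t ht)
    have hd' : HasDerivAt (fun s => chartLift e (γ s) t) (W (t - t₁)) s₀ :=
      hd.congr_of_eventuallyEq (hγΦ.mono fun s hs => hs.2.2)
    exact ⟨⟨hγΦ.mono fun s hs => ⟨hs.1, hs.2.1⟩, hd'.differentiableAt⟩, hd'⟩

theorem IsGeodesicVariation.liftDifferentiableAt_zero (h : IsGeodesicVariation F x β β' γ s₀) :
    LiftDifferentiableAt (chartAt E x) γ s₀ 0 := by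
  have h0 : (0 : ℝ) ∈ Icc (0 : ℝ) 1 := left_mem_Icc.2 zero_le_one
  have hx := mem_chart_source E x
  have hpt : ∀ s, IsGeodesicFrom F x (β s) (γ s) → γ s 0 = x := fun s hs =>
    congrArg Bundle.TotalSpace.proj hs.1
  refine ⟨?_, ?_⟩
  · filter_upwards [h.geodesic] with s hs
    exact ⟨(hpt s hs.2).symm ▸ hx, hs.2.mdifferentiableAt h0⟩
  · let A : E →L[ℝ] E := mfderiv 𝓘(ℝ, E) 𝓘(ℝ, E) (chartAt E x) x
    have h1 : DifferentiableAt ℝ (fun s => ((chartAt E x x, A (β s)) : E × E)) s₀ :=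
      (differentiableAt_const _).prodMk (A.differentiableAt.comp s₀ h.hasDerivAt.differentiableAt)
    refine h1.congr_of_eventuallyEq ?_
    filter_upwards [h.geodesic] with s hs
    have h2 := deriv_chart_comp (chart_mem_atlas E x) (hs.2.mdifferentiableAt h0)
      ((hpt s hs.2).symm ▸ hx)
    refine Prod.ext (congrArg (chartAt E x) (hpt s hs.2)) (h2.deriv.trans ?_)
    exact congrArg (fun p : TangentBundle 𝓘(ℝ, E) M =>
      (mfderiv 𝓘(ℝ, E) 𝓘(ℝ, E) (chartAt E x) p.1 p.2 : E)) hs.2.1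

/-- The variation is differentiable at all times: the times at which it is form a set that contains
`0` and is open and closed in `[0, 1]`. -/
theorem IsGeodesicVariation.liftDifferentiableAt [FiniteDimensional ℝ E] [T2Space M]
    (hF : IsFinslerMetric F) (h : IsGeodesicVariation F x β β' γ s₀) {t : ℝ}
    (ht : t ∈ Icc (0 : ℝ) 1) : ∃ e ∈ atlas E M, LiftDifferentiableAt e γ s₀ t := by
  refine (IsPreconnected.iff_of_locally_iff isPreconnected_Icc
    (P := fun t => ∃ e ∈ atlas E M, LiftDifferentiableAt e γ s₀ t) ?_
    (left_mem_Icc.2 zero_le_one) ht).1 ⟨_, chart_mem_atlas E x, h.liftDifferentiableAt_zero⟩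
  intro tc htc
  obtain ⟨e, he, ε, hε, hloc⟩ := h.exists_variation_field hF htc
  have key : ∀ t₁ ∈ Icc (0 : ℝ) 1 ∩ Metric.ball tc ε, ∀ t₂ ∈ Icc (0 : ℝ) 1 ∩ Metric.ball tc ε,
      (∃ e ∈ atlas E M, LiftDifferentiableAt e γ s₀ t₁) →
        ∃ e ∈ atlas E M, LiftDifferentiableAt e γ s₀ t₂ := by
    rintro t₁ h₁ t₂ h₂ ⟨e', he', hl⟩
    obtain ⟨W, hW⟩ := (hloc t₁ h₁).2 (hl.change_chart he' he (hloc t₁ h₁).1)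
    exact ⟨e, he, ((hW t₂ h₂.2).2 h₂.1).1⟩
  have hc : tc ∈ Icc (0 : ℝ) 1 ∩ Metric.ball tc ε := ⟨htc, Metric.mem_ball_self hε⟩
  filter_upwards [self_mem_nhdsWithin, mem_nhdsWithin_of_mem_nhds (Metric.ball_mem_nhds tc hε)]
    with s hs hs'
  exact ⟨key s ⟨hs, hs'⟩ tc hc, key tc hc s ⟨hs, hs'⟩⟩

/-- The derivative of `F²` along the fibre at the tangent vector `p`, that is, twice the covector
`g_p(p, ·)`. -/
noncomputable def fibreDeriv (F : TangentBundle 𝓘(ℝ, E) M → ℝ) (p : TangentBundle 𝓘(ℝ, E) M) :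
    E →L[ℝ] ℝ :=
  fderiv ℝ (fun v : E => F ⟨p.1, v⟩ ^ 2) p.2

theorem IsFinslerMetric.momentum_apply_eq (hF : IsFinslerMetric F) (he : e ∈ atlas E M)
    {z : E × E} (hz : z.1 ∈ e.target) (hv : z.2 ≠ 0) (j : E) :
    2 * momentum (chartEnergy F e) z j =
      fibreDeriv F (chartTangent e z) (chartTangent e (z.1, j) : TangentBundle 𝓘(ℝ, E) M).2 := by
  obtain ⟨q, v⟩ := z
  simp only at hz hv
  let A : E →L[ℝ] E := mfderiv 𝓘(ℝ, E) 𝓘(ℝ, E) e.symm q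
  have hA : A v ≠ 0 := chartTangent_snd_ne_zero he (z := (q, v)) hz hv
  have hG : HasFDerivAt (fun v : E => F ⟨e.symm q, v⟩ ^ 2) (fibreDeriv F ⟨e.symm q, A v⟩) (A v) :=
    (((hF.contDiffAt_fibre (e.symm q) hA).pow 2).differentiableAt (by simp)).hasFDerivAt
  have h1 : HasFDerivAt (fun v => chartEnergy F e (q, v))
      ((1 / 2 : ℝ) • (fibreDeriv F ⟨e.symm q, A v⟩).comp A) v :=
    (hG.comp v A.hasFDerivAt).const_mul (1 / 2 : ℝ)
  rw [← fderiv_velocity_eq ((hF.contDiffAt_chartEnergy he (z := (q, v)) hz hv).differentiableAt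
    (by simp)), h1.fderiv, FunLike.coe_smul, Pi.smul_apply, smul_eq_mul, ← mul_assoc]
  norm_num
  rfl

/-- **Gauss lemma**. The end points of a variation of geodesics from a fixed point `x` form a
differentiable curve, and the fibre derivative of `F²` at the end velocity pairs with the velocity
of that curve as the fibre derivative of `F²` at the initial velocity pairs with its variation. -/
theorem IsGeodesicVariation.gauss_lemma [FiniteDimensional ℝ E] [T2Space M]
    (hF : IsFinslerMetric F) (h : IsGeodesicVariation F x β β' γ s₀) :
    MDifferentiableAt 𝓘(ℝ, ℝ) 𝓘(ℝ, E) (fun s => γ s 1) s₀ ∧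
      fibreDeriv F (velocity (γ s₀) 1)
        (velocity (fun s => γ s 1) s₀ : TangentBundle 𝓘(ℝ, E) M).2 =
      fderiv ℝ (fun v : E => F ⟨x, v⟩ ^ 2) (β s₀) β' := by
  obtain ⟨hβ, hγ⟩ := h.geodesic.self_of_nhds
  obtain ⟨δ, hδ, hg, hsub⟩ := hγ.exists_isGeodesicOn
  have h01 : (0 : ℝ) ∈ Icc (0 : ℝ) 1 := left_mem_Icc.2 zero_le_one
  have h11 : (1 : ℝ) ∈ Icc (0 : ℝ) 1 := right_mem_Icc.2 zero_le_one
  set D : ℝ := fderiv ℝ (fun v : E => F ⟨x, v⟩ ^ 2) (β s₀) β' with hD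
  have hDd : HasDerivAt (fun s => F ⟨x, β s⟩ ^ 2) D s₀ :=
    (((hF.contDiffAt_fibre x hβ).pow 2).differentiableAt
      (by simp)).hasFDerivAt.comp_hasDerivAt s₀ h.hasDerivAt
  have hmd : ∀ (e : OpenPartialHomeomorph M E), e ∈ atlas E M → ∀ t,
      LiftDifferentiableAt e γ s₀ t → MDifferentiableAt 𝓘(ℝ, ℝ) 𝓘(ℝ, E) (fun s => γ s t) s₀ := by
    intro e he t hl
    have hte := hl.1.self_of_nhds.1
    have h1 : DifferentiableAt ℝ (fun s => e (γ s t)) s₀ := hl.2.fst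
    have h2 : MDifferentiableAt 𝓘(ℝ, ℝ) 𝓘(ℝ, E) (fun s => e.symm (e (γ s t))) s₀ :=
      ((mdifferentiable_of_mem_atlas (I := 𝓘(ℝ, E)) he).mdifferentiableAt_symm
        (e.map_source hte)).comp s₀ h1.mdifferentiableAt
    refine h2.congr_of_eventuallyEq ?_
    filter_upwards [hl.1] with s hs using (e.left_inv hs.1).symm
  set Q : ℝ → ℝ := fun t => fibreDeriv F (velocity (γ s₀) t)
    (velocity (fun s => γ s t) s₀ : TangentBundle 𝓘(ℝ, E) M).2 with hQ
  -- the pairing of momentum and variation field grows at the constant rate `D`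
  have hQd : ∀ t ∈ Icc (0 : ℝ) 1, HasDerivWithinAt Q D (Icc 0 1) t := by
    intro t ht
    obtain ⟨e, he, ε, hε, hloc⟩ := h.exists_variation_field hF ht
    have htm : t ∈ Icc (0 : ℝ) 1 ∩ Metric.ball t ε := ⟨ht, Metric.mem_ball_self hε⟩
    obtain ⟨e', he', hl⟩ := h.liftDifferentiableAt hF ht
    obtain ⟨W, hW⟩ := (hloc t htm).2 (hl.change_chart he' he (hloc t htm).1)
    have hreg : ∀ r ∈ Icc (0 : ℝ) 1 ∩ Metric.ball t ε, γ s₀ r ∈ e.source ∧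
        (chartLift e (γ s₀) r).2 ≠ 0 := by
      intro r hr
      refine ⟨(hloc r hr).1, (velocity_snd_ne_zero_iff he (hγ.mdifferentiableAt hr.1)
        (hloc r hr).1).2 ((hF.apply_ne_zero_iff _).1 ?_)⟩
      rw [hγ.speed_eq hF hr.1]
      exact (hF.pos x _ hβ).ne'
    have hQeq : ∀ r ∈ Icc (0 : ℝ) 1 ∩ Metric.ball t ε,
        Q r = 2 * momentum (chartEnergy F e) (chartLift e (γ s₀) r) (W r).1 := by
      intro r hr
      obtain ⟨hl, hd⟩ := (hW r hr.2).2 hr.1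
      obtain ⟨hs, hv⟩ := hreg r hr
      have h1 : (W r).1 = deriv (e ∘ fun s => γ s r) s₀ :=
        (((hasFDerivAt_fst (𝕜 := ℝ)).comp_hasDerivAt s₀ hd).deriv).symm
      have h2 : chartTangent e ((chartLift e (γ s₀) r).1, (W r).1) =
          velocity (fun s => γ s r) s₀ := by
        rw [h1, ← chartTangent_chartLift he (hmd e he r hl) hs]
        rfl
      rw [hF.momentum_apply_eq he (e.map_source hs) hv, h2,
        chartTangent_chartLift he (hγ.mdifferentiableAt hr.1) hs]
    obtain ⟨hs, hv⟩ := hreg t htm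
    have h1 := hasDerivAt_momentum_apply
      (hg.hasDerivAt_momentum hF isOpen_Ioo he (hsub ht) hs hv) (hW t htm.2).1
    have h2 : HasDerivAt (fun s => chartEnergy F e (chartLift e (γ s) t))
        (fderiv ℝ (chartEnergy F e) (chartLift e (γ s₀) t) (W t)) s₀ :=
      HasFDerivAt.comp_hasDerivAt (l := chartEnergy F e) s₀
        ((hF.contDiffAt_chartEnergy he (e.map_source hs) hv).differentiableAt
        (by simp)).hasFDerivAt ((hW t htm.2).2 ht).2
    have h3 : HasDerivAt (fun s => chartEnergy F e (chartLift e (γ s) t)) (1 / 2 * D) s₀ := by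
      refine (hDd.const_mul (1 / 2)).congr_of_eventuallyEq ?_
      filter_upwards [((hW t htm.2).2 ht).1.1, h.geodesic] with s hs hs'
      rw [chartEnergy_eq, chartTangent_chartLift he hs.2 hs.1, hs'.2.speed_eq hF ht]
    have h4 := (h1.const_mul 2).hasDerivWithinAt (s := Icc 0 1)
    rw [h2.unique h3, ← mul_assoc, mul_one_div_cancel two_ne_zero, one_mul] at h4
    refine h4.congr_of_eventuallyEq ?_ (hQeq t htm)
    filter_upwards [self_mem_nhdsWithin, mem_nhdsWithin_of_mem_nhds (Metric.ball_mem_nhds t hε)]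
      with r hr hr' using hQeq r ⟨hr, hr'⟩
  have hQ0 : Q 0 = 0 := by
    have hconst : (fun s => γ s 0) =ᶠ[𝓝 s₀] fun _ => x := by
      filter_upwards [h.geodesic] with s hs using congrArg Bundle.TotalSpace.proj hs.2.1
    have h1 : (velocity (fun s => γ s 0) s₀ : TangentBundle 𝓘(ℝ, E) M).2 = (0 : E) := by
      have h2 := hconst.mfderiv_eq (I := 𝓘(ℝ, ℝ)) (I' := 𝓘(ℝ, E))
      rw [mfderiv_const] at h2
      exact congrArg (fun B : ℝ →L[ℝ] E => B 1) h2
    exact (congrArg (fibreDeriv F (velocity (γ s₀) 0)) h1).trans (map_zero _)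
  obtain ⟨e, he, hl⟩ := h.liftDifferentiableAt hF h11
  refine ⟨hmd e he 1 hl, ?_⟩
  have hR : ∀ t ∈ Icc (0 : ℝ) 1, HasDerivWithinAt (fun t => Q t - t * D) 0 (Icc 0 1) t := by
    intro t ht
    have := (hQd t ht).sub ((hasDerivAt_mul_const D).hasDerivWithinAt (x := t) (s := Icc 0 1))
    rwa [sub_self] at this
  have hfin := (convex_Icc (0 : ℝ) 1).norm_image_sub_le_of_norm_hasDerivWithin_le (C := 0) hR
    (fun t _ => by simp) h01 h11
  simp only [zero_mul, hQ0, norm_le_zero_iff] at hfin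
  change Q 1 = D
  linarith

end Variation

/-! ### Growth of a function bounded by the integral of its rate -/

section Growth

theorem ofReal_sub_le_lintegral_deriv {r : ℝ → ℝ} {a b : ℝ} (hab : a ≤ b)
    (hr : ContinuousOn r (Icc a b)) (hd : ∀ s ∈ Ioo a b, DifferentiableAt ℝ r s) :
    ENNReal.ofReal (r b - r a) ≤ ∫⁻ s in Ioo a b, ENNReal.ofReal (deriv r s) := by
  by_cases htop : ∫⁻ s in Ioo a b, ENNReal.ofReal (deriv r s) = ⊤
  · rw [htop]; exact le_top
  have hmeas : Measurable fun s => max (deriv r s) 0 := (measurable_deriv r).max measurable_const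
  have hof : ∀ s, ENNReal.ofReal (max (deriv r s) 0) = ENNReal.ofReal (deriv r s) := fun s => by
    rw [ENNReal.ofReal_max, ENNReal.ofReal_zero]; exact max_eq_left bot_le
  have hnn : 0 ≤ᵐ[volume.restrict (Ioo a b)] fun s => max (deriv r s) 0 :=
    .of_forall fun s => le_max_right _ _
  have hint : IntegrableOn (fun s => max (deriv r s) 0) (Ioo a b) := by
    refine ⟨hmeas.aestronglyMeasurable, ?_⟩
    rw [hasFiniteIntegral_iff_ofReal hnn]
    simp only [hof]
    exact Ne.lt_top htop
  have h1 := intervalIntegral.sub_le_integral_of_hasDeriv_right_of_le hab hr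
    (fun s hs => (hd s hs).hasDerivAt.hasDerivWithinAt)
    ((integrableOn_Icc_iff_integrableOn_Ioo (by simp) (by simp)).2 hint)
    (fun s _ => le_max_left (deriv r s) 0)
  rw [intervalIntegral.integral_of_le hab, integral_Ioc_eq_integral_Ioo] at h1
  refine (ENNReal.ofReal_le_ofReal h1).trans (le_of_eq ?_)
  rw [ofReal_integral_eq_lintegral_ofReal hint hnn]
  simp only [hof]

/-- A nonnegative function `r` that need not be differentiable at its zeros grows by at most the
integral of any upper bound `φ` of its derivative off the zeros: `r` is controlled from its last
zero on. No measurability of `φ` is needed. -/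
theorem ofReal_sub_le_lintegral {r : ℝ → ℝ} {φ : ℝ → ℝ≥0∞} {a b : ℝ} (hab : a ≤ b)
    (hr : ContinuousOn r (Icc a b)) (h0 : ∀ s ∈ Icc a b, 0 ≤ r s)
    (hd : ∀ s ∈ Ioo a b, r s ≠ 0 → DifferentiableAt ℝ r s ∧ ENNReal.ofReal (deriv r s) ≤ φ s) :
    ENNReal.ofReal (r b - r a) ≤ ∫⁻ s in Ioo a b, φ s := by
  obtain ⟨d, hd_mem, hra, hpos⟩ : ∃ d ∈ Icc a b, r d ≤ r a ∧ ∀ s ∈ Ioo d b, r s ≠ 0 := by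
    by_cases hz : ∃ s ∈ Icc a b, r s = 0
    · have hcl : IsCompact (Icc a b ∩ r ⁻¹' {0}) :=
        isCompact_Icc.of_isClosed_subset (hr.preimage_isClosed_of_isClosed isClosed_Icc
          isClosed_singleton) inter_subset_left
      obtain ⟨s, hs, hs0⟩ := hz
      obtain ⟨d, hd1, hd2⟩ := hcl.exists_isGreatest ⟨s, hs, hs0⟩
      refine ⟨d, hd1.1, ?_, fun s hs h => ?_⟩
      · rw [show r d = 0 from hd1.2]; exact h0 a (left_mem_Icc.2 hab)
      · exact absurd (hd2 ⟨⟨hd1.1.1.trans hs.1.le, hs.2.le⟩, h⟩) (not_le.2 hs.1)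
    · push Not at hz
      exact ⟨a, left_mem_Icc.2 hab, le_rfl, fun s hs => hz s (Ioo_subset_Icc_self hs)⟩
  have hsub : Ioo d b ⊆ Ioo a b := Ioo_subset_Ioo_left hd_mem.1
  calc ENNReal.ofReal (r b - r a) ≤ ENNReal.ofReal (r b - r d) :=
        ENNReal.ofReal_le_ofReal (by linarith)
    _ ≤ ∫⁻ s in Ioo d b, ENNReal.ofReal (deriv r s) :=
        ofReal_sub_le_lintegral_deriv hd_mem.2 (hr.mono (Icc_subset_Icc_left hd_mem.1))
          fun s hs => (hd s (hsub hs) (hpos s hs)).1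
    _ ≤ ∫⁻ s in Ioo d b, φ s :=
        setLIntegral_mono' measurableSet_Ioo fun s hs => (hd s (hsub hs) (hpos s hs)).2
    _ ≤ ∫⁻ s in Ioo a b, φ s := lintegral_mono_set hsub

theorem lintegral_Ioo_add {φ : ℝ → ℝ≥0∞} {a b c : ℝ} (hab : a ≤ b) (hbc : b ≤ c) :
    ∫⁻ s in Ioo a c, φ s = (∫⁻ s in Ioo a b, φ s) + ∫⁻ s in Ioo b c, φ s := by
  have h : ∀ a b : ℝ, ∫⁻ s in Ioo a b, φ s = ∫⁻ s in Ioc a b, φ s := fun a b =>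
    setLIntegral_congr Ioo_ae_eq_Ioc
  rw [h, h, h, ← Ioc_union_Ioc_eq_Ioc hab hbc,
    lintegral_union measurableSet_Ioc (Ioc_disjoint_Ioc_of_le le_rfl)]

/-- If the total growth equals the integral, then so does the growth over each subinterval. -/
theorem lintegral_eq_ofReal_sub {r : ℝ → ℝ} {φ : ℝ → ℝ≥0∞} {l : ℝ}
    (hle : ∀ a b, 0 ≤ a → a ≤ b → b ≤ l →
      ENNReal.ofReal (r b - r a) ≤ ∫⁻ s in Ioo a b, φ s)
    (htot : ∫⁻ s in Ioo 0 l, φ s = ENNReal.ofReal (r l - r 0)) (hl : r 0 ≤ r l)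
    {a b : ℝ} (ha : 0 ≤ a) (hab : a ≤ b) (hb : b ≤ l) :
    ∫⁻ s in Ioo a b, φ s = ENNReal.ofReal (r b - r a) ∧ r a ≤ r b := by
  have h1 := lintegral_Ioo_add (φ := φ) ha (hab.trans hb)
  have h2 := lintegral_Ioo_add (φ := φ) hab hb
  rw [h2, htot] at h1
  set I₁ := ∫⁻ s in Ioo 0 a, φ s
  set I₂ := ∫⁻ s in Ioo a b, φ s
  set I₃ := ∫⁻ s in Ioo b l, φ s
  have hfin : I₁ + (I₂ + I₃) ≠ ⊤ := h1 ▸ ENNReal.ofReal_ne_top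
  have hf₁ : I₁ ≠ ⊤ := fun h => hfin (by simp [h])
  have hf₂ : I₂ ≠ ⊤ := fun h => hfin (by simp [h])
  have hf₃ : I₃ ≠ ⊤ := fun h => hfin (by simp [h])
  have g₁ := (ENNReal.ofReal_le_iff_le_toReal hf₁).1 (hle 0 a le_rfl ha (hab.trans hb))
  have g₂ := (ENNReal.ofReal_le_iff_le_toReal hf₂).1 (hle a b ha hab hb)
  have g₃ := (ENNReal.ofReal_le_iff_le_toReal hf₃).1 (hle b l (ha.trans hab) hb le_rfl)
  have h3 := congrArg ENNReal.toReal h1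
  rw [ENNReal.toReal_ofReal (by linarith), ENNReal.toReal_add hf₁ (by simp [hf₂, hf₃]),
    ENNReal.toReal_add hf₂ hf₃] at h3
  have h4 : I₂.toReal = r b - r a := by linarith
  refine ⟨by rw [← h4, ENNReal.ofReal_toReal hf₂], ?_⟩
  have := ENNReal.toReal_nonneg (a := I₂)
  linarith

theorem ae_eq_ofReal_deriv {r : ℝ → ℝ} {φ : ℝ → ℝ≥0∞} {a b : ℝ} (hab : a ≤ b)
    (hr : ContinuousOn r (Icc a b))
    (hd : ∀ s ∈ Ioo a b, DifferentiableAt ℝ r s ∧ ENNReal.ofReal (deriv r s) ≤ φ s)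
    (hφ : AEMeasurable φ (volume.restrict (Ioo a b)))
    (heq : ∫⁻ s in Ioo a b, φ s = ENNReal.ofReal (r b - r a)) :
    ∀ᵐ s ∂(volume.restrict (Ioo a b)), ENNReal.ofReal (deriv r s) = φ s := by
  have hle : (∫⁻ s in Ioo a b, ENNReal.ofReal (deriv r s)) ≤ ∫⁻ s in Ioo a b, φ s :=
    setLIntegral_mono' measurableSet_Ioo fun s hs => (hd s hs).2
  refine ae_eq_of_ae_le_of_lintegral_le ?_ ?_ hφ ?_
  · filter_upwards [ae_restrict_mem measurableSet_Ioo] with s hs using (hd s hs).2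
  · exact ne_top_of_le_ne_top (heq ▸ ENNReal.ofReal_ne_top) hle
  · rw [heq]
    exact ofReal_sub_le_lintegral_deriv hab hr fun s hs => (hd s hs).1

/-- A curve with a derivative everywhere that vanishes almost everywhere is constant. -/
theorem eq_of_ae_deriv_eq_zero {G : Type*} [NormedAddCommGroup G] [NormedSpace ℝ G]
    [CompleteSpace G] {u : ℝ → G} {a b : ℝ} (hd : ∀ s ∈ Ioo a b, DifferentiableAt ℝ u s)
    (h0 : ∀ᵐ s ∂(volume.restrict (Ioo a b)), deriv u s = 0) {s t : ℝ} (hs : s ∈ Ioo a b)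
    (ht : t ∈ Ioo a b) : u s = u t := by
  have hsub : uIcc s t ⊆ Ioo a b := ordConnected_Ioo.uIcc_subset hs ht
  have hae : deriv u =ᵐ[volume.restrict (uIoc s t)] fun _ => 0 :=
    ae_mono (Measure.restrict_mono (uIoc_subset_uIcc.trans hsub) le_rfl) h0
  have hint : IntervalIntegrable (deriv u) volume s t := by
    rw [intervalIntegrable_iff]
    exact (integrable_zero ℝ G _).congr hae.symm
  have h1 := intervalIntegral.integral_eq_sub_of_hasDerivAt
    (fun x hx => (hd x (hsub hx)).hasDerivAt) hint
  have h2 : ∫ x in s..t, deriv u x = 0 := by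
    rw [intervalIntegral.integral_congr_ae_restrict hae]; simp
  rw [h2] at h1
  exact (sub_eq_zero.1 h1.symm).symm

end Growth

/-! ### Comparison of speeds under the exponential map -/

section Comparison

variable {E : Type*} [NormedAddCommGroup E] [NormedSpace ℝ E]
  {M : Type*} [TopologicalSpace M] [ChartedSpace E M] [IsManifold 𝓘(ℝ, E) ∞ M]
  {F : TangentBundle 𝓘(ℝ, E) M → ℝ} {x : M} {β : ℝ → E} {β' : E} {γ : ℝ → ℝ → M} {s₀ : ℝ}

/-- The Gauss lemma and the fundamental inequality: the norm of the initial velocity grows at most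
at the speed of the end point, with equality only if the end point moves along the geodesic. -/
theorem IsGeodesicVariation.deriv_norm_le_speed [FiniteDimensional ℝ E] [T2Space M]
    (hF : IsFinslerMetric F) (h : IsGeodesicVariation F x β β' γ s₀) :
    DifferentiableAt ℝ (fun s => F ⟨x, β s⟩) s₀ ∧
    deriv (fun s => F ⟨x, β s⟩) s₀ ≤ F (velocity (fun s => γ s 1) s₀) ∧
    (deriv (fun s => F ⟨x, β s⟩) s₀ = F (velocity (fun s => γ s 1) s₀) →
      (velocity (fun s => γ s 1) s₀ : TangentBundle 𝓘(ℝ, E) M).2 =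
        ((deriv (fun s => F ⟨x, β s⟩) s₀ / F ⟨x, β s₀⟩) •
          (velocity (γ s₀) 1 : TangentBundle 𝓘(ℝ, E) M).2 : E)) := by
  obtain ⟨hβ, hγ⟩ := h.geodesic.self_of_nhds
  have h11 : (1 : ℝ) ∈ Icc (0 : ℝ) 1 := right_mem_Icc.2 zero_le_one
  have hNd : HasFDerivAt (fun v : E => F ⟨x, v⟩) (fderiv ℝ (fun v : E => F ⟨x, v⟩) (β s₀)) (β s₀) :=
    ((hF.contDiffAt_fibre x hβ).differentiableAt (by simp)).hasFDerivAt
  have hr := hNd.comp_hasDerivAt s₀ h.hasDerivAt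
  have hrd : deriv (fun s => F ⟨x, β s⟩) s₀ = fderiv ℝ (fun v : E => F ⟨x, v⟩) (β s₀) β' := hr.deriv
  have hpos : 0 < F ⟨x, β s₀⟩ := hF.pos x _ hβ
  have hsq : fderiv ℝ (fun v : E => F ⟨x, v⟩ ^ 2) (β s₀) β' =
      2 * (F ⟨x, β s₀⟩ * deriv (fun s => F ⟨x, β s⟩) s₀) := by
    rw [hrd, (hNd.pow 2).fderiv]
    simp [mul_assoc]
  have hspeed := hγ.speed_eq hF h11
  have hT : (velocity (γ s₀) 1 : TangentBundle 𝓘(ℝ, E) M).2 ≠ 0 :=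
    (hF.apply_ne_zero_iff _).1 (by rw [hspeed]; exact hpos.ne')
  have hfund := hF.fundamental (γ s₀ 1) hT
    (velocity (fun s => γ s 1) s₀ : TangentBundle 𝓘(ℝ, E) M).2
  have hgauss := (h.gauss_lemma hF).2
  rw [hsq] at hgauss
  have hspeed' : F ⟨γ s₀ 1, (velocity (γ s₀) 1 : TangentBundle 𝓘(ℝ, E) M).2⟩ = F ⟨x, β s₀⟩ := hspeed
  rw [hspeed'] at hfund
  have hfd : fderiv ℝ (fun v : E => F ⟨γ s₀ 1, v⟩ ^ 2)
      (velocity (γ s₀) 1 : TangentBundle 𝓘(ℝ, E) M).2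
      (velocity (fun s => γ s 1) s₀ : TangentBundle 𝓘(ℝ, E) M).2 =
      2 * (F ⟨x, β s₀⟩ * deriv (fun s => F ⟨x, β s⟩) s₀) := hgauss
  rw [hfd] at hfund
  have hw : F ⟨γ s₀ 1, (velocity (fun s => γ s 1) s₀ : TangentBundle 𝓘(ℝ, E) M).2⟩ =
      F (velocity (fun s => γ s 1) s₀) := rfl
  rw [hw] at hfund
  refine ⟨hr.differentiableAt, ?_, fun heq => ?_⟩
  · exact le_of_mul_le_mul_left (by linarith [hfund.1]) hpos
  · have := hfund.2 (by rw [heq])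
    rw [heq]
    exact this

/-- Where the exponential map has maximal rank at a nonzero vector, it is differentiable with
injective differential. -/
theorem ExpHasMaximalRankAt.injective [FiniteDimensional ℝ E] {p : E} (hp : p ≠ 0)
    (h : ExpHasMaximalRankAt F x p) :
    MDifferentiableAt 𝓘(ℝ, E) 𝓘(ℝ, E) (expMap F x) p ∧
      Function.Injective (mfderiv 𝓘(ℝ, E) 𝓘(ℝ, E) (expMap F x) p : E → E) := by
  have key : ∀ A : E →L[ℝ] E,
      Module.finrank ℝ (LinearMap.range A.toLinearMap) = Module.finrank ℝ E →
        Function.Injective A := by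
    intro A hA
    have := Submodule.eq_top_of_finrank_eq hA
    exact LinearMap.injective_iff_surjective.2 (LinearMap.range_eq_top.1 this)
  have hinj : Function.Injective (mfderiv 𝓘(ℝ, E) 𝓘(ℝ, E) (expMap F x) p : E → E) := key _ h
  refine ⟨?_, hinj⟩
  -- otherwise `mfderiv` is zero by convention, hence not injective
  by_contra hmd
  refine hp (hinj ?_)
  have h0 : (mfderiv 𝓘(ℝ, E) 𝓘(ℝ, E) (expMap F x) p : E →L[ℝ] E) = 0 :=
    mfderiv_zero_of_not_mdifferentiableAt hmd
  exact (DFunLike.congr_fun h0 p).trans (DFunLike.congr_fun h0 0).symm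

/-- The speed of a curve is measurable near a point where the curve is differentiable. -/
theorem aemeasurable_speed [FiniteDimensional ℝ E] (hF : IsFinslerMetric F)
    {e : OpenPartialHomeomorph M E} (he : e ∈ atlas E M) {b : ℝ → M} {I : Set ℝ}
    (hI : MeasurableSet I) (hb : ∀ s ∈ I, b s ∈ e.source)
    (hbd : ∀ s ∈ I, MDifferentiableAt 𝓘(ℝ, ℝ) 𝓘(ℝ, E) b s) :
    AEMeasurable (fun s => ENNReal.ofReal (F (velocity b s))) (volume.restrict I) := by
  classical
  have := FiniteDimensional.complete ℝ E
  have := FiniteDimensional.proper_real E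
  let _ : MeasurableSpace E := borel E
  have : BorelSpace E := ⟨rfl⟩
  set Θ : Set (E × E) := e.target ×ˢ univ with hΘ
  have hΘo : IsOpen Θ := e.open_target.prod isOpen_univ
  have hg : Measurable (Θ.piecewise (fun z => F (chartTangent e z)) fun _ => 0) :=
    (hF.continuousOn_chart he).measurable_piecewise continuousOn_const hΘo.measurableSet
  have h1 : AEMeasurable (fun s => e (b s)) (volume.restrict I) := by
    refine ContinuousOn.aemeasurable (fun s hs => ?_) hI
    exact ((e.continuousAt (hb s hs)).comp (hbd s hs).continuousAt).continuousWithinAt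
  have h2 : AEMeasurable (chartLift e b) (volume.restrict I) :=
    h1.prodMk (measurable_deriv (e ∘ b)).aemeasurable
  refine (hg.comp_aemeasurable h2).ennreal_ofReal.congr ?_
  filter_upwards [ae_restrict_mem hI] with s hs
  have h3 : chartLift e b s ∈ Θ := ⟨e.map_source (hb s hs), mem_univ _⟩
  simp only [Function.comp, piecewise_eq_of_mem _ _ _ h3, chartTangent_chartLift he (hbd s hs)
    (hb s hs)]

end Comparison

/-! ### Images of curves under the exponential map -/

section ExpCurve

variable {E : Type*} [NormedAddCommGroup E] [NormedSpace ℝ E]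
  {M : Type*} [TopologicalSpace M] [ChartedSpace E M] [IsManifold 𝓘(ℝ, E) ∞ M]
  {F : TangentBundle 𝓘(ℝ, E) M → ℝ} {x : M} {X : E} {β : ℝ → E} {β' : E} {γ : ℝ → ℝ → M} {s₀ : ℝ}
  {b c : ℝ → M} {l : ℝ}

theorem velocity_congr {c₁ c₂ : ℝ → M} {t : ℝ} (h : c₁ =ᶠ[𝓝 t] c₂) :
    (velocity c₁ t : TangentBundle 𝓘(ℝ, E) M) = velocity c₂ t := by
  have h1 : (mfderiv 𝓘(ℝ, ℝ) 𝓘(ℝ, E) c₁ t : ℝ →L[ℝ] E) =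
      mfderiv 𝓘(ℝ, ℝ) 𝓘(ℝ, E) c₂ t := h.mfderiv_eq
  change (⟨c₁ t, (mfderiv 𝓘(ℝ, ℝ) 𝓘(ℝ, E) c₁ t : ℝ →L[ℝ] E) 1⟩ : TangentBundle 𝓘(ℝ, E) M) =
    ⟨c₂ t, (mfderiv 𝓘(ℝ, ℝ) 𝓘(ℝ, E) c₂ t : ℝ →L[ℝ] E) 1⟩
  rw [h1, h.eq_of_nhds]

theorem velocity_expMap_comp {u : ℝ → E} {u' : E} {t : ℝ}
    (hE : MDifferentiableAt 𝓘(ℝ, E) 𝓘(ℝ, E) (expMap F x) (u t)) (hu : HasDerivAt u u' t)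
    (hc : c =ᶠ[𝓝 t] fun t => expMap F x (u t)) :
    (velocity c t : TangentBundle 𝓘(ℝ, E) M).2 =
      (mfderiv 𝓘(ℝ, E) 𝓘(ℝ, E) (expMap F x) (u t) : E →L[ℝ] E) u' := by
  have h1 : (mfderiv 𝓘(ℝ, ℝ) 𝓘(ℝ, E) c t : ℝ →L[ℝ] E) =
      mfderiv 𝓘(ℝ, ℝ) 𝓘(ℝ, E) (fun t => expMap F x (u t)) t := hc.mfderiv_eq
  have h2 := (hE.hasMFDerivAt.comp t hu.hasFDerivAt.hasMFDerivAt).mfderiv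
  have h3 : (mfderiv 𝓘(ℝ, ℝ) 𝓘(ℝ, E) (fun t => expMap F x (u t)) t : ℝ →L[ℝ] E) 1 =
      (mfderiv 𝓘(ℝ, E) 𝓘(ℝ, E) (expMap F x) (u t) : E →L[ℝ] E) ((1 : ℝ) • u') :=
    DFunLike.congr_fun h2 (1 : ℝ)
  rw [one_smul] at h3
  exact (DFunLike.congr_fun h1 (1 : ℝ)).trans h3

/-- If the end point of a variation of geodesics moves as slowly as the Gauss lemma permits and the
exponential map is an immersion, then the initial velocity moves radially. -/
theorem IsGeodesicVariation.eq_smul_of_deriv_norm_eq [FiniteDimensional ℝ E] [T2Space M]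
    (hF : IsFinslerMetric F) (h : IsGeodesicVariation F x β β' γ s₀)
    (hrank : ExpHasMaximalRankAt F x (β s₀))
    (heq : deriv (fun s => F ⟨x, β s⟩) s₀ = F (velocity (fun s => γ s 1) s₀)) :
    β' = (deriv (fun s => F ⟨x, β s⟩) s₀ / F ⟨x, β s₀⟩) • β s₀ := by
  obtain ⟨hβ, hγ⟩ := h.geodesic.self_of_nhds
  obtain ⟨hmd, hinj⟩ := hrank.injective hβ
  have h1 := velocity_expMap_comp (c := fun s => γ s 1) hmd h.hasDerivAt (by
    filter_upwards [h.geodesic] with s hs using (hs.2.expMap_eq hF).symm)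
  have h2 : (velocity (γ s₀) 1 : TangentBundle 𝓘(ℝ, E) M).2 =
      (mfderiv 𝓘(ℝ, E) 𝓘(ℝ, E) (expMap F x) (β s₀) : E →L[ℝ] E) (β s₀) := by
    obtain ⟨δ, hδ, hg, -⟩ := hγ.exists_isGeodesicOn
    have hu : HasDerivAt (fun t : ℝ => t • β s₀) (β s₀) 1 := by
      simpa using (hasDerivAt_id (1 : ℝ)).smul_const (β s₀)
    have h3 := velocity_expMap_comp (F := F) (x := x) (c := γ s₀) (by simpa using hmd) hu (by
      filter_upwards [Ioo_mem_nhds zero_lt_one (by linarith : (1 : ℝ) < 1 + δ)] with t ht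
      exact (hg.expMap_smul hF hδ hγ.1 ⟨ht.1.le, ht.2⟩).symm)
    rw [h3]
    congr 3
    exact one_smul ℝ (β s₀)
  have h3 := (h.deriv_norm_le_speed hF).2.2 heq
  rw [h1, h2] at h3
  have key : ∀ (A : E →L[ℝ] E) (a : ℝ) (v : E), a • A v = A (a • v) := fun A a v =>
    (map_smul A a v).symm
  exact hinj (h3.trans (key _ _ _))

/-- On `[0, l]` the curve `b` is the image under `Exp_x` of the differentiable curve `β`. -/
structure IsExpCurve (F : TangentBundle 𝓘(ℝ, E) M → ℝ) (x : M) (β : ℝ → E) (b : ℝ → M) (l : ℝ) :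
    Prop where
  differentiableOn : DifferentiableOn ℝ β (Icc 0 l)
  mem_expDomain : ∀ s ∈ Icc 0 l, β s ∈ expDomain F x
  eq_expMap : ∀ s ∈ Icc 0 l, b s = expMap F x (β s)

theorem IsExpCurve.differentiableAt (h : IsExpCurve F x β b l) {s : ℝ} (hs : s ∈ Ioo 0 l) :
    DifferentiableAt ℝ β s :=
  h.differentiableOn.differentiableAt (Icc_mem_nhds hs.1 hs.2)

theorem IsExpCurve.exists_isGeodesicVariation [FiniteDimensional ℝ E] [T2Space M]
    (hF : IsFinslerMetric F) (h : IsExpCurve F x β b l) :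
    ∃ γ : ℝ → ℝ → M, ∀ s ∈ Ioo 0 l, β s ≠ 0 →
      IsGeodesicVariation F x β (deriv β s) γ s ∧ b =ᶠ[𝓝 s] fun s => γ s 1 := by
  have hne : Nonempty M := ⟨x⟩
  have hdom : ∀ s ∈ Icc 0 l, ∃ c, IsGeodesicFrom F x (β s) c := h.mem_expDomain
  choose! γ hγ using hdom
  refine ⟨γ, fun s hs h0 => ⟨⟨?_, (h.differentiableAt hs).hasDerivAt⟩, ?_⟩⟩
  · filter_upwards [Icc_mem_nhds hs.1 hs.2, (h.differentiableAt hs).continuousAt.eventually_ne h0]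
      with r hr hr0 using ⟨hr0, hγ r hr⟩
  · filter_upwards [Icc_mem_nhds hs.1 hs.2] with r hr
    rw [h.eq_expMap r hr, (hγ r hr).expMap_eq hF]

theorem IsFinslerMetric.continuous_fibre (hF : IsFinslerMetric F) (x : M) :
    Continuous fun v : E => F ⟨x, v⟩ :=
  hF.continuous.comp (FiberBundle.continuous_totalSpaceMk E (TangentSpace 𝓘(ℝ, E) : M → Type _) x)

theorem IsExpCurve.continuousOn_norm (hF : IsFinslerMetric F) (h : IsExpCurve F x β b l) :
    ContinuousOn (fun s => F ⟨x, β s⟩) (Icc 0 l) :=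
  (hF.continuous_fibre x).comp_continuousOn h.differentiableOn.continuousOn

theorem IsExpCurve.deriv_norm_le_speed [FiniteDimensional ℝ E] [T2Space M]
    (hF : IsFinslerMetric F) (h : IsExpCurve F x β b l) {s : ℝ} (hs : s ∈ Ioo 0 l)
    (h0 : β s ≠ 0) : DifferentiableAt ℝ (fun s => F ⟨x, β s⟩) s ∧
      ENNReal.ofReal (deriv (fun s => F ⟨x, β s⟩) s) ≤ ENNReal.ofReal (F (velocity b s)) := by
  obtain ⟨γ, hγ⟩ := h.exists_isGeodesicVariation hF
  obtain ⟨hv, hb⟩ := hγ s hs h0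
  have h1 := hv.deriv_norm_le_speed hF
  refine ⟨h1.1, ENNReal.ofReal_le_ofReal ?_⟩
  rw [velocity_congr hb]
  exact h1.2.1

/-- Between two parameters, the image under `Exp_x` of a curve of initial velocities is at least as
long as the norm of the initial velocity grows. -/
theorem IsExpCurve.ofReal_sub_le_length [FiniteDimensional ℝ E] [T2Space M]
    (hF : IsFinslerMetric F) (h : IsExpCurve F x β b l) {u v : ℝ} (hu : 0 ≤ u) (huv : u ≤ v)
    (hv : v ≤ l) : ENNReal.ofReal (F ⟨x, β v⟩ - F ⟨x, β u⟩) ≤ length F b u v := by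
  refine ofReal_sub_le_lintegral (r := fun s => F ⟨x, β s⟩) huv
    ((h.continuousOn_norm hF).mono (Icc_subset_Icc hu hv)) (fun s _ => hF.nonneg _) ?_
  intro s hs h0
  exact h.deriv_norm_le_speed hF (Ioo_subset_Ioo hu hv hs) ((hF.apply_ne_zero_iff _).1 h0)

/-- If the image under `Exp_x` is no longer than the norm of the initial velocity grows, then the
direction `β / F(β)` is stationary wherever it is defined. -/
theorem IsExpCurve.hasDerivAt_direction [FiniteDimensional ℝ E] [T2Space M]
    (hF : IsFinslerMetric F) (h : IsExpCurve F x β b l)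
    (hlen : ∀ u v, 0 ≤ u → u ≤ v → v ≤ l →
      length F b u v = ENNReal.ofReal (F ⟨x, β v⟩ - F ⟨x, β u⟩) ∧ F ⟨x, β u⟩ ≤ F ⟨x, β v⟩)
    (hrank : ∀ s ∈ Icc 0 l, ExpHasMaximalRankAt F x (β s)) {s : ℝ} (hs : s ∈ Ioo 0 l)
    (h0 : β s ≠ 0) : HasDerivAt (fun s => (F ⟨x, β s⟩)⁻¹ • β s) 0 s := by
  have := FiniteDimensional.complete ℝ E
  obtain ⟨γ, hγ⟩ := h.exists_isGeodesicVariation hF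
  have hmd : ∀ r ∈ Ioo 0 l, β r ≠ 0 → MDifferentiableAt 𝓘(ℝ, ℝ) 𝓘(ℝ, E) b r := fun r hr hr0 =>
    ((hγ r hr hr0).1.gauss_lemma hF).1.congr_of_eventuallyEq (hγ r hr hr0).2
  obtain ⟨e, he, hse⟩ : ∃ e ∈ atlas E M, b s ∈ e.source :=
    ⟨chartAt E (b s), chart_mem_atlas E (b s), mem_chart_source E (b s)⟩
  -- work on an interval around `s` where `β ≠ 0` and `b` stays in one chart
  have hev : ∀ᶠ r in 𝓝 s, r ∈ Ioo 0 l ∧ β r ≠ 0 ∧ b r ∈ e.source := by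
    filter_upwards [Ioo_mem_nhds hs.1 hs.2, (h.differentiableAt hs).continuousAt.eventually_ne h0,
      (hmd s hs h0).continuousAt.eventually_mem (e.open_source.mem_nhds hse)] with r h1 h2 h3
      using ⟨h1, h2, h3⟩
  obtain ⟨ε, hε, hball⟩ := Metric.eventually_nhds_iff_ball.1 hev
  rw [Real.ball_eq_Ioo] at hball
  set u := s - ε / 2 with hu
  set v := s + ε / 2 with hv
  have hI : ∀ r ∈ Icc u v, r ∈ Ioo 0 l ∧ β r ≠ 0 ∧ b r ∈ e.source := fun r hr =>
    hball r ⟨by linarith [hr.1], by linarith [hr.2]⟩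
  have huv : u ≤ v := by linarith
  have hu0 := (hI u (left_mem_Icc.2 huv)).1
  have hv0 := (hI v (right_mem_Icc.2 huv)).1
  have hI' : ∀ r ∈ Ioo u v, r ∈ Ioo 0 l ∧ β r ≠ 0 ∧ b r ∈ e.source := fun r hr =>
    hI r (Ioo_subset_Icc_self hr)
  have hd : ∀ r ∈ Ioo u v, DifferentiableAt ℝ (fun s => F ⟨x, β s⟩) r := fun r hr =>
    (h.deriv_norm_le_speed hF (hI' r hr).1 (hI' r hr).2.1).1
  have hae := ae_eq_ofReal_deriv (r := fun s => F ⟨x, β s⟩)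
    (φ := fun s => ENNReal.ofReal (F (velocity b s))) huv
    ((h.continuousOn_norm hF).mono (Icc_subset_Icc hu0.1.le hv0.2.le))
    (fun r hr => h.deriv_norm_le_speed hF (hI' r hr).1 (hI' r hr).2.1)
    (aemeasurable_speed hF he measurableSet_Ioo (fun r hr => (hI' r hr).2.2)
      fun r hr => hmd r (hI' r hr).1 (hI' r hr).2.1)
    (hlen u v hu0.1.le huv hv0.2.le).1
  have hmono : MonotoneOn (fun s => F ⟨x, β s⟩) (Ioo u v) := fun r hr r' hr' hrr' =>
    (hlen r r' (hI' r hr).1.1.le hrr' (hI' r' hr').1.2.le).2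
  have hpos : ∀ r ∈ Ioo u v, F ⟨x, β r⟩ ≠ 0 := fun r hr => (hF.pos x _ (hI' r hr).2.1).ne'
  have hdir : ∀ r ∈ Ioo u v, HasDerivAt (fun s => (F ⟨x, β s⟩)⁻¹ • β s)
      ((F ⟨x, β r⟩)⁻¹ • deriv β r +
        (-deriv (fun s => F ⟨x, β s⟩) r / F ⟨x, β r⟩ ^ 2) • β r) r := fun r hr =>
    ((hd r hr).hasDerivAt.inv (hpos r hr)).smul (h.differentiableAt (hI' r hr).1).hasDerivAt
  have hdir0 : ∀ᵐ r ∂(volume.restrict (Ioo u v)),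
      deriv (fun s => (F ⟨x, β s⟩)⁻¹ • β s) r = 0 := by
    filter_upwards [hae, ae_restrict_mem measurableSet_Ioo] with r hr hr'
    obtain ⟨hvar, hb⟩ := hγ r (hI' r hr').1 (hI' r hr').2.1
    have hnn : 0 ≤ deriv (fun s => F ⟨x, β s⟩) r := by
      rw [← derivWithin_of_isOpen isOpen_Ioo hr']
      exact hmono.derivWithin_nonneg
    have heq : deriv (fun s => F ⟨x, β s⟩) r = F (velocity b r) :=
      (ENNReal.ofReal_eq_ofReal_iff hnn (hF.nonneg _)).1 hr
    rw [velocity_congr hb] at heq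
    have h1 := hvar.eq_smul_of_deriv_norm_eq hF
      (hrank r (Ioo_subset_Icc_self (hI' r hr').1)) heq
    rw [(hdir r hr').deriv, h1, smul_smul, ← add_smul]
    convert zero_smul ℝ (β r) using 2
    have := hpos r hr'
    field_simp
    ring
  have hsm : s ∈ Ioo u v := ⟨by linarith, by linarith⟩
  refine (hasDerivAt_const s ((F ⟨x, β s⟩)⁻¹ • β s)).congr_of_eventuallyEq ?_
  filter_upwards [Ioo_mem_nhds hsm.1 hsm.2] with r hr
  exact eq_of_ae_deriv_eq_zero (fun r hr => (hdir r hr).differentiableAt) hdir0 hr hsm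

/-- If the image under `Exp_x` is no longer than the norm of the initial velocity grows, then the
initial velocities are multiples of the last one. -/
theorem IsExpCurve.eq_smul [FiniteDimensional ℝ E] [T2Space M]
    (hF : IsFinslerMetric F) (h : IsExpCurve F x β b l)
    (hlen : ∀ u v, 0 ≤ u → u ≤ v → v ≤ l →
      length F b u v = ENNReal.ofReal (F ⟨x, β v⟩ - F ⟨x, β u⟩) ∧ F ⟨x, β u⟩ ≤ F ⟨x, β v⟩)
    (hrank : ∀ s ∈ Icc 0 l, ExpHasMaximalRankAt F x (β s)) (hβ0 : β 0 = 0) {s : ℝ}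
    (hs : s ∈ Icc 0 l) : β s = (F ⟨x, β s⟩ / F ⟨x, β l⟩) • β l := by
  rcases eq_or_ne (β s) 0 with h0 | h0
  · rw [h0, hF.apply_zero, zero_div, zero_smul]
  have hs0 : 0 < s := hs.1.lt_of_ne fun hs' => h0 (by rw [← hs', hβ0])
  have hpos : ∀ r ∈ Icc s l, 0 < F ⟨x, β r⟩ := fun r hr =>
    (hF.pos x _ h0).trans_le (hlen s r hs.1 hr.1 hr.2).2
  have hsub : Icc s l ⊆ Icc 0 l := Icc_subset_Icc_left hs.1
  have hcont : ContinuousOn (fun s => (F ⟨x, β s⟩)⁻¹ • β s) (Icc s l) :=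
    (((h.continuousOn_norm hF).mono hsub).inv₀ fun r hr => (hpos r hr).ne').smul
      (h.differentiableOn.continuousOn.mono hsub)
  have hconst := constant_of_has_deriv_right_zero hcont (fun r hr =>
    (h.hasDerivAt_direction hF hlen hrank ⟨hs0.trans_le hr.1, hr.2⟩
      ((hF.apply_ne_zero_iff _).1 (hpos r (Ico_subset_Icc_self hr)).ne')).hasDerivWithinAt)
    l (right_mem_Icc.2 hs.2)
  have hp := (hpos s (left_mem_Icc.2 hs.2)).ne'
  calc β s = F ⟨x, β s⟩ • (F ⟨x, β s⟩)⁻¹ • β s := (smul_inv_smul₀ hp _).symm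
    _ = F ⟨x, β s⟩ • (F ⟨x, β l⟩)⁻¹ • β l := by rw [hconst]
    _ = _ := by rw [smul_smul, div_eq_mul_inv]

theorem IsGeodesicFrom.length_eq (hF : IsFinslerMetric F) {γ : ℝ → M}
    (h : IsGeodesicFrom F x X γ) (hc : ∀ t ∈ Icc (0 : ℝ) 1, c t = γ t) :
    length F c 0 1 = ENNReal.ofReal (F ⟨x, X⟩) := by
  have h1 : ∀ t ∈ Ioo (0 : ℝ) 1, ENNReal.ofReal (F (velocity c t)) = ENNReal.ofReal (F ⟨x, X⟩) := by
    intro t ht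
    rw [velocity_congr (c₂ := γ) (by
      filter_upwards [Icc_mem_nhds ht.1 ht.2] with r hr using hc r hr),
      h.speed_eq hF (Ioo_subset_Icc_self ht)]
  rw [length, setLIntegral_congr_fun measurableSet_Ioo h1]
  simp

/-- The length of a monotone reparametrization of a piece of a geodesic, which has constant
speed. -/
theorem IsGeodesicFrom.length_comp (hF : IsFinslerMetric F) {γ : ℝ → M}
    (h : IsGeodesicFrom F x X γ) {τ : ℝ → ℝ} (hl : 0 ≤ l) (hd : DifferentiableOn ℝ τ (Icc 0 l))
    (hm : MonotoneOn τ (Icc 0 l)) (hτ : ∀ s ∈ Icc 0 l, τ s ∈ Icc (0 : ℝ) 1)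
    (hb : ∀ s ∈ Icc 0 l, b s = γ (τ s)) :
    length F b 0 l = ENNReal.ofReal (F ⟨x, X⟩) * ENNReal.ofReal (τ l - τ 0) := by
  have h1 : ∀ s ∈ Ioo 0 l, ENNReal.ofReal (F (velocity b s)) =
      ENNReal.ofReal (derivWithin τ (Icc 0 l) s) * ENNReal.ofReal (F ⟨x, X⟩) := by
    intro s hs
    have hs' := Ioo_subset_Icc_self hs
    have hτ' := (hd s hs').hasDerivWithinAt.hasDerivAt (Icc_mem_nhds hs.1 hs.2)
    have hnn : 0 ≤ derivWithin τ (Icc 0 l) s := hm.derivWithin_nonneg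
    rw [velocity_congr (c₂ := fun s => γ (τ s)) (by
      filter_upwards [Icc_mem_nhds hs.1 hs.2] with r hr using hb r hr),
      velocity_comp hτ' (h.mdifferentiableAt (hτ s hs')), ← ENNReal.ofReal_mul hnn,
      ← h.speed_eq hF (hτ s hs')]
    exact congrArg ENNReal.ofReal (hF.homogeneous _ _ _ hnn)
  have himg : τ '' Icc 0 l = Icc (τ 0) (τ l) :=
    (hm.mapsTo_Icc.image_subset).antisymm (intermediate_value_Icc hl hd.continuousOn)
  have h2 := lintegral_image_eq_lintegral_deriv_mul_of_monotoneOn measurableSet_Icc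
    (fun s hs => (hd s hs).hasDerivWithinAt) hm fun _ => ENNReal.ofReal (F ⟨x, X⟩)
  rw [himg, setLIntegral_const, Real.volume_Icc] at h2
  rw [length, setLIntegral_congr_fun measurableSet_Ioo h1, h2]
  exact setLIntegral_congr Ioo_ae_eq_Icc

end ExpCurve

end Finsler

open Finsler in
theorem proposition1p2
    {E : Type*} [NormedAddCommGroup E] [NormedSpace ℝ E] [FiniteDimensional ℝ E]
    {M : Type*} [TopologicalSpace M] [T2Space M] [ChartedSpace E M] [IsManifold 𝓘(ℝ, E) ∞ M]
    (F : TangentBundle 𝓘(ℝ, E) M → ℝ) (hF : Finsler.IsFinslerMetric F)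
    (x : M) (X : E) (hX : X ∈ Finsler.expDomain F x)
    (s₁ : ℝ) (hs₁ : 0 < s₁)
    (bt : ℝ → E)
    (hbt : DifferentiableOn ℝ bt (Set.Icc 0 s₁))
    (hbt_dom : ∀ s ∈ Set.Icc 0 s₁, bt s ∈ Finsler.expDomain F x)
    (hbt_zero : bt 0 = 0) (hbt_end : bt s₁ = X)
    (b c : ℝ → M)
    (hb : ∀ s ∈ Set.Icc 0 s₁, b s = Finsler.expMap F x (bt s))
    (hc : ∀ t ∈ Set.Icc (0 : ℝ) 1, c t = Finsler.expMap F x (t • X)) :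
    Finsler.length F c 0 1 ≤ Finsler.length F b 0 s₁ ∧
    (∀ τ : ℝ → ℝ, DifferentiableOn ℝ τ (Set.Icc 0 s₁) → MonotoneOn τ (Set.Icc 0 s₁) →
      (∀ s ∈ Set.Icc 0 s₁, τ s ∈ Set.Icc (0 : ℝ) 1) →
      (∀ s ∈ Set.Icc 0 s₁, bt s = τ s • X) →
      Finsler.length F c 0 1 = Finsler.length F b 0 s₁) ∧
    (Finsler.length F c 0 1 = Finsler.length F b 0 s₁ →
      (∀ s ∈ Set.Icc 0 s₁, ∀ t ∈ Set.Icc (0 : ℝ) 1,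
        Finsler.ExpHasMaximalRankAt F x (t • bt s)) →
      ∃ τ : ℝ → ℝ, DifferentiableOn ℝ τ (Set.Icc 0 s₁) ∧
        (∀ k : ℕ∞, ContDiffOn ℝ k bt (Set.Icc 0 s₁) → ContDiffOn ℝ k τ (Set.Icc 0 s₁)) ∧
        MonotoneOn τ (Set.Icc 0 s₁) ∧
        (∀ s ∈ Set.Icc 0 s₁, τ s ∈ Set.Icc (0 : ℝ) 1) ∧
        (∀ s ∈ Set.Icc 0 s₁, bt s = τ s • X) ∧
        ((∀ u ∈ Set.Icc 0 s₁, ∀ v ∈ Set.Icc 0 s₁, u < v → ∃ s ∈ Set.Icc u v, bt s ≠ bt u) →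
          StrictMonoOn τ (Set.Icc 0 s₁))) := by

  have hcurve : IsExpCurve F x bt b s₁ := ⟨hbt, hbt_dom, hb⟩
  obtain ⟨γ, hγ⟩ : ∃ γ, IsGeodesicFrom F x X γ := hX
  obtain ⟨δ, hδ, hg, -⟩ := hγ.exists_isGeodesicOn
  have hexp : ∀ t ∈ Icc (0 : ℝ) 1, expMap F x (t • X) = γ t := fun t ht =>
    hg.expMap_smul hF hδ hγ.1 ⟨ht.1, by linarith [ht.2]⟩
  have hlc : length F c 0 1 = ENNReal.ofReal (F ⟨x, X⟩) :=
    hγ.length_eq hF fun t ht => (hc t ht).trans (hexp t ht)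
  have hr0 : F ⟨x, bt 0⟩ = 0 := by rw [hbt_zero, hF.apply_zero]
  have hle : ∀ u v, 0 ≤ u → u ≤ v → v ≤ s₁ →
      ENNReal.ofReal (F ⟨x, bt v⟩ - F ⟨x, bt u⟩) ≤ length F b u v := fun u v hu huv hv =>
    hcurve.ofReal_sub_le_length hF hu huv hv
  refine ⟨?_, ?_, ?_⟩
  · have := hle 0 s₁ le_rfl hs₁.le le_rfl
    rwa [hr0, sub_zero, hbt_end, ← hlc] at this
  · intro τ hd hm hτ hbτ
    have hb' : ∀ s ∈ Icc 0 s₁, b s = γ (τ s) := fun s hs => by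
      rw [hb s hs, hbτ s hs, hexp _ (hτ s hs)]
    rw [hlc, hγ.length_comp hF hs₁.le hd hm hτ hb']
    rcases eq_or_ne X 0 with rfl | hX0
    · simp [hF.apply_zero]
    have h0 : τ 0 = 0 := by
      have := hbτ 0 (left_mem_Icc.2 hs₁.le)
      rw [hbt_zero] at this
      exact (smul_eq_zero.1 this.symm).resolve_right hX0
    have h1 : τ s₁ = 1 := by
      have := hbτ s₁ (right_mem_Icc.2 hs₁.le)
      rw [hbt_end] at this
      exact smul_left_injective ℝ hX0 (by simpa using this.symm)
    rw [h0, h1]; simp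
  · intro hlen hrank
    have hrank' : ∀ s ∈ Icc 0 s₁, ExpHasMaximalRankAt F x (bt s) := fun s hs => by
      simpa using hrank s hs 1 (right_mem_Icc.2 zero_le_one)
    have hlen' : ∀ u v, 0 ≤ u → u ≤ v → v ≤ s₁ →
        length F b u v = ENNReal.ofReal (F ⟨x, bt v⟩ - F ⟨x, bt u⟩) ∧
          F ⟨x, bt u⟩ ≤ F ⟨x, bt v⟩ := fun u v hu huv hv =>
      lintegral_eq_ofReal_sub (r := fun s => F ⟨x, bt s⟩) hle
        (by rw [hr0, sub_zero, hbt_end, ← hlc, hlen]; rfl)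
        (by rw [hr0]; exact hF.nonneg _) hu huv hv
    have hrad : ∀ s ∈ Icc 0 s₁, bt s = (F ⟨x, bt s⟩ / F ⟨x, X⟩) • X := fun s hs => by
      have := hcurve.eq_smul hF hlen' hrank' hbt_zero hs
      rwa [hbt_end] at this
    rcases eq_or_ne X 0 with rfl | hX0
    · refine ⟨fun _ => 0, differentiableOn_const _, fun k _ => contDiffOn_const,
        monotoneOn_const, fun s _ => ⟨le_rfl, zero_le_one⟩, fun s hs => ?_, fun hne => ?_⟩
      · rw [hrad s hs, smul_zero, smul_zero]
      · obtain ⟨s, hs, hs'⟩ := hne 0 (left_mem_Icc.2 hs₁.le) s₁ (right_mem_Icc.2 hs₁.le) hs₁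
        exact absurd (by rw [hrad s hs, smul_zero, hbt_zero]) hs'
    obtain ⟨ℓ, hℓ⟩ := SeparatingDual.exists_eq_one (R := ℝ) hX0
    have hXpos := hF.pos x X hX0
    -- a functional with value `1` at `X` reads off the coefficient without loss of regularity
    have hτ : ∀ s ∈ Icc 0 s₁, ℓ (bt s) = F ⟨x, bt s⟩ / F ⟨x, X⟩ := fun s hs => by
      have := congrArg ℓ (hrad s hs)
      rwa [map_smul, hℓ, smul_eq_mul, mul_one] at this
    have hmono : MonotoneOn (fun s => ℓ (bt s)) (Icc 0 s₁) := fun u hu v hv huv => by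
      simp only [hτ u hu, hτ v hv]
      exact div_le_div_of_nonneg_right (hlen' u v hu.1 huv hv.2).2 hXpos.le
    have heq : ∀ s ∈ Icc 0 s₁, bt s = ℓ (bt s) • X := fun s hs => by
      rw [hτ s hs, ← hrad s hs]
    refine ⟨fun s => ℓ (bt s), ℓ.differentiable.comp_differentiableOn hbt,
      fun k hk => ℓ.contDiff.comp_contDiffOn hk, hmono, fun s hs => ⟨?_, ?_⟩, heq, ?_⟩
    · simp only [hτ s hs]
      exact div_nonneg (hF.nonneg _) hXpos.le
    · have := hmono hs (right_mem_Icc.2 hs₁.le) hs.2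
      simpa only [hbt_end, hℓ] using this
    · intro hne u hu v hv huv
      refine (hmono hu hv huv.le).lt_of_ne fun huv' => ?_
      obtain ⟨s, hs, hs'⟩ := hne u hu v hv huv
      have hs0 : s ∈ Icc 0 s₁ := ⟨hu.1.trans hs.1, hs.2.trans hv.2⟩
      refine hs' ?_
      have hsu : ℓ (bt s) = ℓ (bt u) :=
        le_antisymm ((hmono hs0 hv hs.2).trans huv'.ge) (hmono hu hs0 hs.1)
      rw [heq s hs0, heq u hu, hsu]
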